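/- Let $M$ be a smooth (Hausdorff, second countable, finite-dimensional) manifold and $N\in\mathbb N$. Let $\mathcal F^\bullet$ be a weighted sub-Riemannian structure of depth $N$: a family $0=\mathcal F^0\subseteq\mathcal F^1\subseteq\cdots\subseteq\mathcal F^N=\mathcal X(M)$ of finitely generated $C^\infty(M,\mathbb R)$-modules of vector fields with $[\mathcal F^i,\mathcal F^j]\subseteq\mathcal F^{i+j}$ for all $i,j$, where $\mathcal F^i=\mathcal F^N$ for $i\ge N$. For $x\in M$ let $I_x\subseteq C^\infty(M,\mathbb R)$ be the ideal of functions vanishing at $x$, and let $$\mathfrak{gr}(\mathcal F)_x=\bigoplus_{i=1}^N\frac{\mathcal F^i}{\mathcal F^{i-1}+I_x\mathcal F^i}.$$ Write $[X]_{i,x}$ for the class of $X\in\mathcal F^i$. The space $\mathfrak{gr}(\mathcal F)_x$ is a graded nilpotent Lie algebra with $[[X]_{i,x},[Y]_{j,x}]=[[X,Y]]_{i+j,x}$ if $i+j\le N$ and $0$ otherwise, and a Lie group for the Baker-Campbell-Hausdorff product $v\cdot w=v+w-\frac12[v,w]+\frac1{12}[v,[v,w]]+\cdots$, with $v^{-1}=-v$.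 Let $(V,\natural)$ be a graded basis: a finite-dimensional graded real vector space $V=\bigoplus_{i=1}^NV^i$ with a linear map $\natural:V\to\mathcal X(M)$ such that $\natural(V^k)\subseteq\mathcal F^k$ and $\natural(\bigoplus_{i\le k}V^i)$ generates the $C^\infty(M,\mathbb R)$-module $\mathcal F^k$ for $1\le k\le N$. For $t>0$ put $\natural_{x,t}:V\to T_xM$, $\natural_{x,t}(\sum_i v_i)=\sum_i t^i\natural(v_i)(x)$, and $\natural_{x,0}:V\to\mathfrak{gr}(\mathcal F)_x$, $\natural_{x,0}(\sum_i v_i)=\sum_i[\natural(v_i)]_{i,x}$, where $v_i\in V^i$; these maps are surjective. Let $\mathrm{Grass}(\mathcal F)_x$ and $\mathrm{Grass}(V)$ be the Grassmannians of subspaces of codimension $\dim M$ of $\mathfrak{gr}(\mathcal F)_x$ and of $V$. Give the set $$\mathrm{Grass}(\mathfrak a\mathcal F)=M\times\mathbb R_+^\times\ \sqcup\ \bigsqcup_{x\in M}\mathrm{Grass}(\mathcal F)_x\times\{(x,0)\}$$ the topology that makes the injective map to $\mathrm{Grass}(V)\times M\times\mathbb R_+$ given by $(x,t)\mapsto(\ker\natural_{x,t},x,t)$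 and $(L,x,0)\mapsto(\natural_{x,0}^{-1}(L),x,0)$ an embedding, and let $$\mathcal G^0_x=\{L\in\mathrm{Grass}(\mathcal F)_x:(L,x,0)\in\overline{M\times\mathbb R_+^\times}\}.$$ Theorem. Let $x\in M$. 1. If $L\in\mathcal G^0_x$, then $L$ is a Lie subalgebra and a Lie subgroup of $\mathfrak{gr}(\mathcal F)_x$. 2. If $g\in\mathfrak{gr}(\mathcal F)_x$ and $L\in\mathcal G^0_x$, then $gLg^{-1}\in\mathcal G^0_x$. -/

import Mathlib

open scoped Manifold ContDiff Topology


noncomputable section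

namespace SubRiem

section VectorFields

variable (E : Type*) [NormedAddCommGroup E] [NormedSpace ℝ E]
  (M : Type*) [TopologicalSpace M] [ChartedSpace E M]

/-- The ring `C^∞(M, ℝ)` of smooth real functions on a manifold modelled on `E`. -/
abbrev SmoothFun := C^∞⟮𝓘(ℝ, E), M; 𝓘(ℝ, ℝ), ℝ⟯

variable [IsManifold 𝓘(ℝ, E) ∞ M]

/-- The space `𝒳(M)` of smooth vector fields: smooth sections of the tangent bundle. -/
abbrev VField := Cₛ^∞⟮𝓘(ℝ, E); E, (TangentSpace 𝓘(ℝ, E) : M → Type _)⟯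

variable {E M}

instance : SMul (SmoothFun E M) (VField E M) where
  smul f X := ⟨fun y => f y • X y, f.contMDiff.smul_section X.contMDiff⟩

theorem smul_apply (f : SmoothFun E M) (X : VField E M) (y : M) : (f • X) y = f y • X y := rfl

instance : Module (SmoothFun E M) (VField E M) where
  one_smul X := by ext y; simp [smul_apply]
  mul_smul f g X := by ext y; simp [smul_apply, mul_smul]
  smul_zero f := by ext y; simp [smul_apply]
  smul_add f X Y := by ext y; simp [smul_apply]
  add_smul f g X := by ext y; simp [smul_apply, add_smul]
  zero_smul X := by ext y; simp [smul_apply]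

instance : IsScalarTower ℝ (SmoothFun E M) (VField E M) where
  smul_assoc c f X := by ext y; simp [smul_apply, mul_smul]

/-- Evaluation of smooth vector fields at a point, with values in the tangent space. -/
def evalVF (x : M) : VField E M →ₗ[ℝ] TangentSpace 𝓘(ℝ, E) x where
  toFun X := X x
  map_add' _ _ := rfl
  map_smul' _ _ := rfl

variable [FiniteDimensional ℝ E]

/-- The Lie bracket of two smooth vector fields. -/
instance : Bracket (VField E M) (VField E M) where
  bracket X Y := ⟨VectorField.mlieBracket 𝓘(ℝ, E) X Y, by
    have : IsManifold 𝓘(ℝ, E) (((⊤ : ℕ∞) : ℕ∞ω) + 1) M :=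
      inferInstanceAs (IsManifold 𝓘(ℝ, E) ∞ M)
    have : IsManifold 𝓘(ℝ, E) (minSmoothness ℝ 2) M :=
      IsManifold.of_le (n := ∞) (by simpa using ENat.LEInfty.out)
    have : CompleteSpace E := FiniteDimensional.complete ℝ E
    exact ContDiff.mlieBracket_vectorField (n := ⊤) (m := ⊤) X.contMDiff Y.contMDiff (by simp)⟩

instance : LieRing (VField E M) where
  add_lie X Y Z := by
    ext y
    have : IsManifold 𝓘(ℝ, E) (minSmoothness ℝ 2) M := IsManifold.of_le (n := ∞) (by simpa using ENat.LEInfty.out)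
    have : CompleteSpace E := FiniteDimensional.complete ℝ E
    exact VectorField.mlieBracket_add_left X.mdifferentiableAt Y.mdifferentiableAt
  lie_add X Y Z := by
    ext y
    have : CompleteSpace E := FiniteDimensional.complete ℝ E
    exact VectorField.mlieBracket_add_right Y.mdifferentiableAt Z.mdifferentiableAt
  lie_self X := by
    ext y
    exact congrFun (VectorField.mlieBracket_self (I := 𝓘(ℝ, E)) (V := X)) y
  leibniz_lie X Y Z := by
    ext y
    have : IsManifold 𝓘(ℝ, E) (minSmoothness ℝ 3) M := IsManifold.of_le (n := ∞) (by simpa using ENat.LEInfty.out)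
    have : CompleteSpace E := FiniteDimensional.complete ℝ E
    exact VectorField.leibniz_identity_mlieBracket_apply
      ((X.contMDiff y).of_le (by simpa using ENat.LEInfty.out)) ((Y.contMDiff y).of_le (by simpa using ENat.LEInfty.out))
      ((Z.contMDiff y).of_le (by simpa using ENat.LEInfty.out))

instance : LieAlgebra ℝ (VField E M) where
  lie_smul c X Y := by
    ext y
    have : CompleteSpace E := FiniteDimensional.complete ℝ E
    exact VectorField.mlieBracket_const_smul_right Y.mdifferentiableAt

/-- The derivative `X f` of a smooth function along a smooth vector field. -/
def lieDeriv (X : VField E M) (f : SmoothFun E M) : SmoothFun E M :=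
  ⟨fun y => mfderiv 𝓘(ℝ, E) 𝓘(ℝ, ℝ) f y (X y), by
    have h1 : ContMDiff 𝓘(ℝ, E).tangent 𝓘(ℝ, ℝ).tangent ∞ (tangentMap 𝓘(ℝ, E) 𝓘(ℝ, ℝ) f) :=
      f.contMDiff.contMDiff_tangentMap (by simp)
    exact (contMDiff_snd_tangentBundle_modelSpace ℝ 𝓘(ℝ, ℝ)).comp (h1.comp X.contMDiff)⟩

theorem lie_smul_fun (X Y : VField E M) (f : SmoothFun E M) :
    ⁅X, f • Y⁆ = lieDeriv X f • Y + f • ⁅X, Y⁆ := by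
  ext y
  have : CompleteSpace E := FiniteDimensional.complete ℝ E
  exact VectorField.mlieBracket_smul_right (f.contMDiff.mdifferentiableAt (by simp))
    Y.mdifferentiableAt

theorem evalVF_surjective [T2Space M] (x : M) :
    Function.Surjective (evalVF (E := E) x) := by
  intro v
  obtain ⟨s, hs, hsm⟩ := FiberBundle.exists_contMDiffOn_extend (k := ∞) 𝓘(ℝ, E) E
    (V := (TangentSpace 𝓘(ℝ, E) : M → Type _)) v
  obtain ⟨u, hus, huo, hxu⟩ := mem_nhds_iff.1 hs
  obtain ⟨φ, -, hφ⟩ := (SmoothBumpFunction.nhds_basis_tsupport (I := 𝓘(ℝ, E)) x).mem_iff.1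
    (huo.mem_nhds hxu)
  refine ⟨⟨_, ContMDiffOn.smul_section_of_tsupport φ.contMDiff.contMDiffOn huo hφ
    (hsm.mono hus)⟩, ?_⟩
  change φ x • FiberBundle.extend E v x = v
  rw [φ.eq_one]
  simp

end VectorFields

section Grassmannian

/-- The Grassmannian of the linear subspaces of codimension `d` of a real vector space. -/
def Grass (V : Type*) [AddCommGroup V] [Module ℝ V] (d : ℕ) : Type _ :=
  {L : Submodule ℝ V // Module.finrank ℝ (V ⧸ L) = d}

variable {V : Type*} [AddCommGroup V] [Module ℝ V]

/-- The kernel of a linear map onto a space of dimension `d`, as a point of the Grassmannian. -/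
def kerGrass {W : Type*} [AddCommGroup W] [Module ℝ W] {d : ℕ} (hW : Module.finrank ℝ W = d)
    (f : V →ₗ[ℝ] W) (hf : Function.Surjective f) : Grass V d :=
  ⟨LinearMap.ker f, by rw [(f.quotKerEquivOfSurjective hf).finrank_eq, hW]⟩

/-- The preimage of a subspace of codimension `d` under a surjective linear map. -/
def comapGrass {W : Type*} [AddCommGroup W] [Module ℝ W] {d : ℕ}
    (f : V →ₗ[ℝ] W) (hf : Function.Surjective f) (L : Grass W d) : Grass V d :=
  ⟨L.1.comap f, by
    have h : Function.Surjective (L.1.mkQ ∘ₗ f) := L.1.mkQ_surjective.comp hf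
    have hk : LinearMap.ker (L.1.mkQ ∘ₗ f) = L.1.comap f := by
      rw [LinearMap.ker_comp, Submodule.ker_mkQ]
    rw [← hk, ((L.1.mkQ ∘ₗ f).quotKerEquivOfSurjective h).finrank_eq, L.2]⟩

/-- The topology of the Grassmannian of codimension `d` subspaces of a finite-dimensional space
`V`: the quotient topology for `f ↦ ker f`, where `f` ranges over the surjective linear maps
`V → ℝ^d`, an open subset of the finite-dimensional space `Hom(V, ℝ^d)` (with the canonical
topology of a finite-dimensional real vector space). -/
instance (d : ℕ) : TopologicalSpace (Grass V d) :=
  TopologicalSpace.coinduced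
    (fun f : {f : V →ₗ[ℝ] (Fin d → ℝ) // Function.Surjective f} =>
      kerGrass (by simp) f.1 f.2)
    (TopologicalSpace.induced Subtype.val (moduleTopology ℝ (V →ₗ[ℝ] (Fin d → ℝ))))

end Grassmannian

section BCH

variable {𝔤 : Type*} [LieRing 𝔤] [LieAlgebra ℝ 𝔤]

/-- The right-nested bracket `[x₁, [x₂, … [xₘ₋₁, xₘ] … ]]` of a word; it is `x₁` for `m = 1`. -/
def nestedBracket : List 𝔤 → 𝔤
  | [] => 0
  | [x] => x
  | x :: y :: l => ⁅x, nestedBracket (y :: l)⁆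

/-- The word `u^{r₁} v^{s₁} ⋯ u^{rₖ} v^{sₖ}`. -/
def dynkinWord {k : ℕ} (r s : Fin k → ℕ) (u v : 𝔤) : List 𝔤 :=
  (List.ofFn fun i => List.replicate (r i) u ++ List.replicate (s i) v).flatten

/-- The Baker-Campbell-Hausdorff product on a Lie algebra in which all brackets of more than `N`
letters vanish, given by Dynkin's formula. The Lie algebra of a Lie group is taken to consist of
the right-invariant vector fields, so that `u · v = u + v - [u,v]/2 + [u,[u,v]]/12 + ⋯`;
compared with the usual formula each bracket of `m` letters has the extra sign `(-1)^(m-1)`.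
The summands that are left out (`k > N`, or some exponent larger than `N`) have more than `N`
letters. -/
def bchMul (N : ℕ) (u v : 𝔤) : 𝔤 :=
  ∑ k ∈ Finset.Icc 1 N, ∑ r : Fin k → Fin (N + 1), ∑ s : Fin k → Fin (N + 1),
    if ∀ i, 0 < (r i : ℕ) + s i then
      (((-1 : ℝ) ^ (k - 1) / k) * ((-1 : ℝ) ^ ((∑ i, ((r i : ℕ) + s i)) - 1) /
        ((∑ i, ((r i : ℕ) + s i) : ℕ) * ∏ i, (((r i : ℕ).factorial : ℝ) * (s i : ℕ).factorial)))) •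
        nestedBracket (dynkinWord (fun i => (r i : ℕ)) (fun i => (s i : ℕ)) u v)
    else 0

end BCH

section Osculating

variable {E : Type*} [NormedAddCommGroup E] [NormedSpace ℝ E] [FiniteDimensional ℝ E]
  {M : Type*} [TopologicalSpace M] [ChartedSpace E M] [IsManifold 𝓘(ℝ, E) ∞ M]

variable (E M) in
/-- A weighted sub-Riemannian structure of depth `N`: finitely generated `C^∞(M, ℝ)`-modules
`0 = F⁰ ⊆ F¹ ⊆ ⋯ ⊆ F^N = 𝒳(M)` of vector fields with `[Fⁱ, Fʲ] ⊆ Fⁱ⁺ʲ`, where `Fⁱ = F^N` for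
`i ≥ N`. -/
structure WeightedSubRiem (N : ℕ) where
  mod : ℕ → Submodule (SmoothFun E M) (VField E M)
  mod_zero : mod 0 = ⊥
  mono : Monotone mod
  mod_eq_top : ∀ k, N ≤ k → mod k = ⊤
  fg : ∀ k, (mod k).FG
  lie_mem : ∀ i j, ∀ X ∈ mod i, ∀ Y ∈ mod j, ⁅X, Y⁆ ∈ mod (i + j)

/-- The ideal `I_x` of the smooth functions vanishing at `x`. -/
def vanishIdeal (x : M) : Ideal (SmoothFun E M) where
  carrier := {f : SmoothFun E M | f x = 0}
  add_mem' {f g} hf hg := by simp_all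
  zero_mem' := by simp
  smul_mem' c f hf := by simp_all

variable {N : ℕ} (F : WeightedSubRiem E M N) (x : M)

namespace WeightedSubRiem

/-- The module `F^k` as a real vector space. -/
def modR (k : ℕ) : Submodule ℝ (VField E M) := (F.mod k).restrictScalars ℝ

/-- The module `F^(k-1) + I_x F^k` as a real vector space. -/
def relR (k : ℕ) : Submodule ℝ (VField E M) :=
  (F.mod (k - 1) ⊔ (vanishIdeal x : Ideal (SmoothFun E M)) • F.mod k).restrictScalars ℝ

/-- The graded piece `F^k / (F^(k-1) + I_x F^k)`. -/
abbrev Piece (k : ℕ) : Type _ := F.modR k ⧸ (F.relR x k).submoduleOf (F.modR k)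

/-- The osculating space `⨁_{k=1}^N F^k / (F^(k-1) + I_x F^k)`. -/
def Osc : Type _ := ∀ k : Set.Icc 1 N, F.Piece x k

instance : AddCommGroup (F.Osc x) := inferInstanceAs (AddCommGroup (∀ k : Set.Icc 1 N, F.Piece x k))
instance : Module ℝ (F.Osc x) := inferInstanceAs (Module ℝ (∀ k : Set.Icc 1 N, F.Piece x k))

/-- The projection of the osculating space onto its degree `k` piece. -/
def proj (k : Set.Icc 1 N) : F.Osc x →ₗ[ℝ] F.Piece x k := LinearMap.proj k

/-- The inclusion of the degree `k` piece into the osculating space. -/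
def incl (k : Set.Icc 1 N) : F.Piece x k →ₗ[ℝ] F.Osc x :=
  LinearMap.single ℝ (fun k : Set.Icc 1 N => F.Piece x k) k

open Classical in
/-- The class `[X]_{k,x}` of a vector field `X ∈ F^k`, as an element of the osculating space. It is
zero if `k` is not one of the degrees `1, …, N`. -/
def cls (k : ℕ) : F.modR k →ₗ[ℝ] F.Osc x :=
  if h : k ∈ Set.Icc 1 N then F.incl x ⟨k, h⟩ ∘ₗ Submodule.mkQ _ else 0

/-- The Lie bracket of vector fields `F^i × F^j → F^(i+j)`. -/
def modBracket (i j : ℕ) : F.modR i →ₗ[ℝ] F.modR j →ₗ[ℝ] F.modR (i + j) :=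
  LinearMap.mk₂ ℝ (fun X Y => ⟨⁅X.1, Y.1⁆, F.lie_mem i j X.1 X.2 Y.1 Y.2⟩)
    (fun X X' Y => Subtype.ext (add_lie X.1 X'.1 Y.1))
    (fun c X Y => Subtype.ext (smul_lie c X.1 Y.1))
    (fun X Y Y' => Subtype.ext (lie_add X.1 Y.1 Y'.1))
    (fun c X Y => Subtype.ext (lie_smul c X.1 Y.1))

variable {F x}

theorem cls_eq_zero {k : ℕ} (X : F.modR k) (hX : X.1 ∈ F.relR x k) : F.cls x k X = 0 := by
  unfold cls
  split_ifs with h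
  · have : Submodule.mkQ ((F.relR x k).submoduleOf (F.modR k)) X = 0 := by
      rw [Submodule.mkQ_apply, Submodule.Quotient.mk_eq_zero]
      exact hX
    exact (congrArg (F.incl x ⟨k, h⟩) this).trans (map_zero _)
  · rfl

theorem lie_mem_relR {i j : ℕ} (hi : 1 ≤ i) {X Y : VField E M} (hX : X ∈ F.relR x i)
    (hY : Y ∈ F.modR j) (hj : 1 ≤ j) : ⁅Y, X⁆ ∈ F.relR x (i + j) := by
  obtain ⟨A, hA, B, hB, rfl⟩ := Submodule.mem_sup.1 hX
  rw [lie_add]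
  refine add_mem ?_ ?_
  · refine Submodule.mem_sup_left ?_
    have := F.lie_mem _ _ _ hY _ hA
    rwa [show i + j - 1 = j + (i - 1) by omega]
  · refine Submodule.smul_induction_on hB ?_ ?_
    · intro f hf Z hZ
      rw [lie_smul_fun]
      refine add_mem (Submodule.mem_sup_left ?_) (Submodule.mem_sup_right ?_)
      · exact Submodule.smul_mem _ _ (F.mono (by omega) hZ)
      · refine Submodule.smul_mem_smul hf ?_
        rw [add_comm]
        exact F.lie_mem _ _ _ hY _ hZ
    · intro P Q hP hQ
      rw [lie_add]
      exact add_mem hP hQ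

variable (F x)

/-- The bracket `([X]_{i,x}, [Y]_{j,x}) ↦ [[X, Y]]_{i+j,x}` of graded pieces. -/
def pieceBracket (i j : Set.Icc 1 N) : F.Piece x i →ₗ[ℝ] F.Piece x j →ₗ[ℝ] F.Osc x :=
  LinearMap.liftQ₂ _ _ ((F.modBracket i j).compr₂ (F.cls x (i + j)))
    (by
      intro X hX
      ext Y
      refine cls_eq_zero _ ?_
      change ⁅X.1, Y.1⁆ ∈ _
      rw [← lie_skew]
      exact neg_mem (lie_mem_relR i.2.1 hX Y.2 j.2.1))
    (by
      intro Y hY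
      ext X
      refine cls_eq_zero _ ?_
      change ⁅X.1, Y.1⁆ ∈ _
      rw [add_comm]
      exact lie_mem_relR j.2.1 hY X.2 i.2.1)

/-- The bilinear extension of the brackets of the graded pieces. -/
def oscBracket : F.Osc x →ₗ[ℝ] F.Osc x →ₗ[ℝ] F.Osc x :=
  ∑ i : Set.Icc 1 N, ∑ j : Set.Icc 1 N, (F.pieceBracket x i j).compl₁₂ (F.proj x i) (F.proj x j)

variable {F x}

theorem cls_congr {k l : ℕ} (h : k = l) {X : F.modR k} {Y : F.modR l} (hXY : X.1 = Y.1) :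
    F.cls x k X = F.cls x l Y := by
  subst h
  rw [Subtype.ext hXY]

theorem proj_cls_self (k : Set.Icc 1 N) (X : F.modR k) :
    F.proj x k (F.cls x k X) = Submodule.Quotient.mk X := by
  simp only [cls, dif_pos k.2, proj, incl]
  exact Pi.single_eq_same (M := fun k : Set.Icc 1 N => F.Piece x k) k _

theorem proj_cls_of_ne {k l : Set.Icc 1 N} (h : k ≠ l) (X : F.modR k) :
    F.proj x l (F.cls x k X) = 0 := by
  simp only [cls, dif_pos k.2, proj, incl]
  exact Pi.single_eq_of_ne (M := fun k : Set.Icc 1 N => F.Piece x k) h.symm _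

theorem cls_of_notMem {k : ℕ} (h : k ∉ Set.Icc 1 N) (X : F.modR k) : F.cls x k X = 0 := by
  simp [cls, h]

theorem exists_eq_sum_cls (u : F.Osc x) :
    ∃ X : ∀ k : Set.Icc 1 N, F.modR k, u = ∑ k : Set.Icc 1 N, F.cls x k (X k) := by
  choose X hX using fun k : Set.Icc 1 N => Submodule.Quotient.mk_surjective _ (F.proj x k u)
  refine ⟨X, ?_⟩
  suffices h : ∀ l, F.proj x l u = F.proj x l (∑ k : Set.Icc 1 N, F.cls x k (X k)) from funext h
  intro l
  rw [map_sum, Finset.sum_eq_single l]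
  · rw [proj_cls_self, hX]
  · intro k _ hk
    exact proj_cls_of_ne hk _
  · simp

theorem osc_induction {p : F.Osc x → Prop} (h0 : p 0) (hadd : ∀ u v, p u → p v → p (u + v))
    (hcls : ∀ k : ℕ, 1 ≤ k → ∀ X : F.modR k, p (F.cls x k X)) (u : F.Osc x) : p u := by
  obtain ⟨X, rfl⟩ := exists_eq_sum_cls u
  exact Finset.sum_induction _ p hadd h0 fun k _ => hcls k k.2.1 (X k)

theorem oscBracket_cls {i j : ℕ} (hi : 1 ≤ i) (hj : 1 ≤ j) (X : F.modR i) (Y : F.modR j) :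
    F.oscBracket x (F.cls x i X) (F.cls x j Y) = F.cls x (i + j) (F.modBracket i j X Y) := by
  by_cases hiN : i ≤ N
  swap
  · rw [cls_of_notMem (k := i) (by simp; omega), cls_of_notMem (k := i + j) (by simp; omega)]
    simp
  by_cases hjN : j ≤ N
  swap
  · rw [cls_of_notMem (k := j) (by simp; omega), cls_of_notMem (k := i + j) (by simp; omega)]
    simp
  lift i to Set.Icc 1 N using ⟨hi, hiN⟩
  lift j to Set.Icc 1 N using ⟨hj, hjN⟩
  simp only [oscBracket, LinearMap.sum_apply, LinearMap.compl₁₂_apply]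
  rw [Finset.sum_eq_single i, Finset.sum_eq_single j]
  · rw [proj_cls_self, proj_cls_self]
    rfl
  · intro l _ hl
    rw [proj_cls_of_ne hl.symm, map_zero]
  · simp
  · intro l _ hl
    refine Finset.sum_eq_zero fun m _ => ?_
    rw [proj_cls_of_ne hl.symm, map_zero, LinearMap.zero_apply]
  · simp

theorem oscBracket_skew (u v : F.Osc x) : F.oscBracket x u v = -F.oscBracket x v u := by
  induction u using osc_induction with
  | h0 => simp
  | hadd u u' h h' => simp [h, h']; abel
  | hcls i hi X =>
    induction v using osc_induction with
    | h0 => simp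
    | hadd v v' h h' => simp [h, h']; abel
    | hcls j hj Y =>
      rw [oscBracket_cls hi hj, oscBracket_cls hj hi, ← map_neg]
      exact cls_congr (add_comm i j) (lie_skew X.1 Y.1).symm

theorem oscBracket_leibniz (u v w : F.Osc x) :
    F.oscBracket x u (F.oscBracket x v w) =
      F.oscBracket x (F.oscBracket x u v) w + F.oscBracket x v (F.oscBracket x u w) := by
  induction u using osc_induction with
  | h0 => simp
  | hadd u u' h h' => simp [h, h']; abel
  | hcls i hi X =>
    induction v using osc_induction with
    | h0 => simp
    | hadd v v' h h' => simp [h, h']; abel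
    | hcls j hj Y =>
      induction w using osc_induction with
      | h0 => simp
      | hadd w w' h h' => simp [h, h']; abel
      | hcls k hk Z =>
        rw [oscBracket_cls hi hj, oscBracket_cls hj hk, oscBracket_cls hi hk,
          oscBracket_cls hi (by omega), oscBracket_cls (by omega) hk, oscBracket_cls hj (by omega),
          cls_congr (k := i + j + k) (l := i + (j + k)) (by omega)
            (Y := ⟨⁅⁅X.1, Y.1⁆, Z.1⁆, by
              have := F.lie_mem _ _ _ (F.lie_mem _ _ _ X.2 _ Y.2) _ Z.2
              rwa [add_assoc] at this⟩) rfl,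
          cls_congr (k := j + (i + k)) (l := i + (j + k)) (by omega)
            (Y := ⟨⁅Y.1, ⁅X.1, Z.1⁆⁆, by
              have := F.lie_mem _ _ _ Y.2 _ (F.lie_mem _ _ _ X.2 _ Z.2)
              rwa [show j + (i + k) = i + (j + k) by omega] at this⟩) rfl, ← map_add]
        exact cls_congr rfl (leibniz_lie X.1 Y.1 Z.1)

/-- The Lie bracket of the osculating Lie algebra, determined by
`[[X]_{i,x}, [Y]_{j,x}] = [[X, Y]]_{i+j,x}`, which is `0` if `i + j > N`. -/
instance : LieRing (F.Osc x) where
  bracket u v := F.oscBracket x u v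
  add_lie u v w := by simp
  lie_add u v w := by simp
  lie_self u := by
    have h := oscBracket_skew u u
    have h2 : (2 : ℝ) • F.oscBracket x u u = 0 := by
      rw [two_smul]
      nth_rewrite 1 [h]
      simp
    simpa using h2
  leibniz_lie := oscBracket_leibniz

instance : LieAlgebra ℝ (F.Osc x) where
  lie_smul c u v := map_smul (F.oscBracket x u) c v

/-- The product of the osculating group: the space `F.Osc x` with the Baker-Campbell-Hausdorff
product of its Lie algebra. Brackets of more than `N` letters vanish there, since the degrees
are `1, …, N`. The neutral element is `0` and the inverse of `u` is `-u`. -/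
def oscMul (u v : F.Osc x) : F.Osc x := bchMul N u v

/-- The conjugate `g · v · g⁻¹` in the osculating group. -/
def oscConj (g v : F.Osc x) : F.Osc x := oscMul (oscMul g v) (-g)

/-- A set of elements of the osculating group is a subgroup. (A linear subspace of the
finite-dimensional space `F.Osc x` is a closed submanifold, so a linear subspace which is a subgroup
is a closed Lie subgroup.) -/
def IsOscSubgroup (S : Set (F.Osc x)) : Prop :=
  0 ∈ S ∧ (∀ u ∈ S, ∀ v ∈ S, oscMul u v ∈ S) ∧ ∀ u ∈ S, -u ∈ S

end WeightedSubRiem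

/-- A graded basis `(V, ♮)` of a weighted sub-Riemannian structure: a graded real vector space
`V = ⨁ Vⁱ`, `1 ≤ i ≤ N`, and a linear map `♮ : V → 𝒳(M)`, given by its restrictions to the `Vⁱ`,
such that `♮(V^k) ⊆ F^k` and `♮(V^1 ⊕ ⋯ ⊕ V^k)` generates the module `F^k`. -/
structure GradedBasis (V : Set.Icc 1 N → Type*) [∀ i, AddCommGroup (V i)]
    [∀ i, Module ℝ (V i)] where
  nat : ∀ i, V i →ₗ[ℝ] VField E M
  nat_mem : ∀ (i : Set.Icc 1 N) (v : V i), nat i v ∈ F.mod i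
  span_eq : ∀ k : Set.Icc 1 N,
    Submodule.span (SmoothFun E M) {X | ∃ v : ∀ i, V i, (∀ i : Set.Icc 1 N, k < i → v i = 0) ∧
      X = ∑ i : Set.Icc 1 N, nat i (v i)} = F.mod k

namespace GradedBasis

variable {F} {V : Set.Icc 1 N → Type*} [∀ i, AddCommGroup (V i)] [∀ i, Module ℝ (V i)]
  (B : GradedBasis F V)

/-- The map `♮_t : V → 𝒳(M)`, `∑ vᵢ ↦ ∑ tⁱ ♮(vᵢ)`. -/
def natT (t : ℝ) : (∀ i, V i) →ₗ[ℝ] VField E M :=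
  ∑ i : Set.Icc 1 N, t ^ (i : ℕ) • (B.nat i ∘ₗ LinearMap.proj i)

/-- The map `♮_{x,t} : V → T_x M`, `v ↦ ♮_t(v)(x)`. -/
def natAt (x : M) (t : ℝ) : (∀ i, V i) →ₗ[ℝ] TangentSpace 𝓘(ℝ, E) x :=
  evalVF x ∘ₗ B.natT t

/-- The map `♮_{x,0} : V → 𝔤𝔯(F)_x`, `∑ vᵢ ↦ ∑ [♮(vᵢ)]_{i,x}`. -/
def natZero (x : M) : (∀ i, V i) →ₗ[ℝ] F.Osc x :=
  ∑ i : Set.Icc 1 N,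
    F.cls x i ∘ₗ (B.nat i).codRestrict (F.modR i) (B.nat_mem i) ∘ₗ LinearMap.proj i

theorem natAt_apply (x : M) (t : ℝ) (v : ∀ i, V i) :
    B.natAt x t v = ∑ i : Set.Icc 1 N, t ^ (i : ℕ) • evalVF x (B.nat i (v i)) := by
  simp [natAt, natT]

theorem natAt_surjective [T2Space M] (x : M) {t : ℝ} (ht : 0 < t) :
    Function.Surjective (B.natAt x t) := by
  intro w
  obtain ⟨X, rfl⟩ := evalVF_surjective x w
  rcases Nat.eq_zero_or_pos N with rfl | hN
  · have hX : X ∈ F.mod 0 := by rw [F.mod_eq_top 0 le_rfl]; trivial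
    rw [F.mod_zero, Submodule.mem_bot] at hX
    exact ⟨0, by simp [hX]⟩
  have hX : X ∈ F.mod N := by rw [F.mod_eq_top N le_rfl]; trivial
  have hs := B.span_eq ⟨N, hN, le_rfl⟩
  simp only at hs
  rw [← hs] at hX
  change evalVF x X ∈ LinearMap.range (B.natAt x t)
  induction hX using Submodule.span_induction with
  | mem X hX =>
    obtain ⟨v, -, rfl⟩ := hX
    refine ⟨fun i => (t ^ (i : ℕ))⁻¹ • v i, ?_⟩
    rw [natAt_apply, map_sum]
    refine Finset.sum_congr rfl fun i _ => ?_
    rw [map_smul, map_smul, smul_smul, mul_inv_cancel₀ (pow_pos ht _).ne', one_smul]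
  | zero => rw [map_zero]; exact zero_mem _
  | add X Y _ _ h h' => rw [map_add]; exact add_mem h h'
  | smul f X _ h => exact Submodule.smul_mem _ (f x) h

theorem natZero_apply (x : M) (v : ∀ i, V i) :
    B.natZero x v = ∑ i : Set.Icc 1 N, F.cls x i ⟨B.nat i (v i), B.nat_mem i (v i)⟩ := by
  simp [natZero, LinearMap.sum_apply]
  rfl

theorem natZero_single (x : M) (k : Set.Icc 1 N) (v : V k) :
    B.natZero x (Pi.single k v) = F.cls x k ⟨B.nat k v, B.nat_mem k v⟩ := by
  classical
  rw [natZero_apply, Finset.sum_eq_single k]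
  · simp
  · intro i _ hi
    simp [Pi.single_eq_of_ne hi]
    exact map_zero (F.cls x i)
  · simp

theorem natZero_surjective (x : M) : Function.Surjective (B.natZero x) := by
  classical
  suffices h : ∀ (k : Set.Icc 1 N) (X : VField E M) (hX : X ∈ F.mod k),
      F.cls x k ⟨X, hX⟩ ∈ LinearMap.range (B.natZero x) by
    intro u
    obtain ⟨X, rfl⟩ := WeightedSubRiem.exists_eq_sum_cls u
    exact Submodule.sum_mem _ fun k _ => h k (X k).1 (X k).2
  intro k X hX
  have hX' := hX
  rw [← B.span_eq k] at hX'
  induction hX' using Submodule.span_induction with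
  | mem X hX' =>
    obtain ⟨v, hv, rfl⟩ := hX'
    refine ⟨Pi.single k (v k), ?_⟩
    rw [natZero_single, eq_comm, ← sub_eq_zero, ← map_sub]
    refine WeightedSubRiem.cls_eq_zero _ (Submodule.mem_sup_left ?_)
    change ∑ i : Set.Icc 1 N, B.nat i (v i) - B.nat k (v k) ∈ F.mod (k - 1)
    rw [← Finset.sum_erase_eq_sub (Finset.mem_univ k)]
    refine sum_mem fun i hi => ?_
    rcases lt_or_ge k i with hki | hki
    · rw [hv i hki, map_zero]
      exact zero_mem _
    · have : (i : ℕ) < k := lt_of_le_of_ne hki (fun h => Finset.ne_of_mem_erase hi (Subtype.ext h))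
      exact F.mono (by omega) (B.nat_mem i (v i))
  | zero =>
    have : F.cls x k ⟨0, hX⟩ = 0 := map_zero (F.cls x k)
    rw [this]
    exact zero_mem _
  | add X Y hX1 hY1 h h' =>
    rw [B.span_eq k] at hX1 hY1
    have := add_mem (h hX1) (h' hY1)
    rwa [← map_add] at this
  | smul f X hX1 h =>
    rw [B.span_eq k] at hX1
    have := Submodule.smul_mem _ (f x) (h hX1)
    rw [← map_smul] at this
    convert! this using 1
    rw [← sub_eq_zero, ← map_sub]
    refine WeightedSubRiem.cls_eq_zero _ (Submodule.mem_sup_right ?_)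
    have hf : f - algebraMap ℝ (SmoothFun E M) (f x) ∈ vanishIdeal (E := E) x := by
      change f x - f x = 0
      exact sub_self _
    have h2 := Submodule.smul_mem_smul hf hX1
    rw [sub_smul, algebraMap_smul] at h2
    exact h2

end GradedBasis

/-- The Grassmannian of the subspaces of codimension `dim M` of the osculating space at `x`. -/
abbrev WeightedSubRiem.GrassAt : Type _ := Grass (F.Osc x) (Module.finrank ℝ E)

/-- The set `M × ℝ_{>0} ⊔ ⨆ₓ Grass(F)_x × {(x, 0)}`. -/
def WeightedSubRiem.GrassSpace : Type _ := (M × Set.Ioi (0 : ℝ)) ⊕ (Σ x : M, F.GrassAt x)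

namespace GradedBasis

variable {F} {V : Set.Icc 1 N → Type*} [∀ i, AddCommGroup (V i)] [∀ i, Module ℝ (V i)]
  (B : GradedBasis F V) [T2Space M]

/-- The map sending `(x, t)` with `t > 0` to `(ker ♮_{x,t}, x, t)` and `(L, x, 0)` to
`(♮_{x,0}⁻¹(L), x, 0)`. -/
def grassNat : F.GrassSpace → Grass (∀ i, V i) (Module.finrank ℝ E) × M × NNReal
  | Sum.inl (x, t) => (kerGrass (W := TangentSpace 𝓘(ℝ, E) x) rfl (B.natAt x t)
      (B.natAt_surjective x t.2), x, ⟨t, t.2.le⟩)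
  | Sum.inr ⟨x, L⟩ => (comapGrass (B.natZero x) (B.natZero_surjective x) L, x, 0)

/-- The topology of `F.GrassSpace` that makes `B.grassNat` an embedding. -/
@[reducible] def grassTopology : TopologicalSpace F.GrassSpace :=
  TopologicalSpace.induced B.grassNat inferInstance

/-- The set `𝒢⁰_x` of limit subspaces at `x`: those `L` of codimension `dim M` in the osculating
space for which `(L, x, 0)` lies in the closure of `M × ℝ_{>0}`. -/
def limitSubspaces (x : M) : Set (F.GrassAt x) :=
  {L | (Sum.inr ⟨x, L⟩ : F.GrassSpace) ∈
    @closure _ B.grassTopology (Set.range (Sum.inl : M × Set.Ioi (0 : ℝ) → F.GrassSpace))}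

end GradedBasis

end Osculating
end SubRiem

end

/-!
Let `L` be a limit subspace at `x`. Its preimage in `V` is a limit of the subspaces `ker ♮_{y,t}`,
as `(y, t)` tends to `(x, 0)` with `t > 0`. Both statements follow by passing to the limit in
properties of these kernels. What makes the limit accessible is that the bracket of vector fields
lifts to `V` (`GradedBasis.exists_bracket_lift`): since `♮` generates the modules `F^k` and `[Fⁱ,
Fʲ] ⊆ Fⁱ⁺ʲ`, there are bilinear maps `C_{y,t}` on `V`, depending smoothly on `y` and polynomially
on `t`, with `♮_{y,t} (C_{y,t}(u, v)) = [♮_t u, ♮_t v](y)`, and `C_{x,0}` lifts the bracket of the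
osculating Lie algebra through `♮_{x,0}`. Convergence in the Grassmannian is replaced by
convergence of linear maps `V → ℝᵈ` that define the subspaces
(`GradedBasis.mem_limitSubspaces_iff`).

*Subalgebras.* The bracket of two vector fields that vanish at `y` vanishes at `y`, so `C_{y,t}`
maps `ker ♮_{y,t} × ker ♮_{y,t}` to `ker ♮_{y,t}`. In the limit `C_{x,0}` preserves the preimage
of `L`, so that `L` is a Lie subalgebra (`GradedBasis.lie_mem_of_mem_limitSubspaces`). It is then
a subgroup, as the Baker-Campbell-Hausdorff product consists of brackets.

*Conjugation.* Let `g = ♮_{x,0}(ĝ)`. Along an integral curve `z` of `♮_t(ĝ)` the solutions of `Φ'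
= -C_{z,t}(ĝ, ·) Φ` carry the kernel of `♮_{z(0),t}` to that of `♮_{z(s),t}`: for `v` in the first
kernel, `♮_{z,t}(Φ v)` solves a homogeneous linear equation, by the bracket relation
(`apply_eq_zero_of_integral_curve`). For `t = 0` the curve is constant, and `Φ` is the exponential
of `-s C_{x,0}(ĝ, ·)`, which covers `exp (-s ad g)`. As flows depend continuously on all data,
`exp (-s ad g) L` is again a limit subspace for small `s`, and hence for `s = 1`
(`GradedBasis.exists_mem_limitSubspaces_eq_map_oscAd`).

It remains to see that conjugation by `g` for the product defined by Dynkin's formula is `exp (-ad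
g)` (`WeightedSubRiem.oscConj_eq_oscAd`). The osculating Lie algebra has a faithful representation
by endomorphisms such that all products of more than `N` of them vanish, namely the adjoint action
on its extension by the derivation that multiplies degree `k` by `k`. This reduces the claim to
Dynkin's formula for `n = exp x exp y - 1` in an associative algebra in which long words in `x`,
`y` vanish (`texp_dynkinSeries`). For the formula, adjoin an element `θ` with `[θ, x] = x` and
`[θ, y] = y`, so that `ad θ` multiplies each word and each bracket by its length. Conjugation by
`1 + n` is `1 + ν = exp (ad x) exp (ad y)`, so `ad (log (1 + n)) θ = log (1 + ν) θ`, and expanding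
the right-hand side into words `ad x`, `ad y` applied to `θ` gives the brackets in Dynkin's
formula. All identities between `exp` and `log` are identities between polynomials in the exponent
of `(1 + n)ˢ`, and it is enough to verify them for natural numbers `s`
(`sum_functional_smul_eq_zero`).
-/

noncomputable section

namespace SubRiem

/-! ### Truncated exponential and logarithm -/

section TruncatedExpLog

open Polynomial

/-- The polynomial function `s ↦ s (s - 1) ⋯ (s - j + 1) / j!` interpolating the binomial
coefficients. -/
def binomPoly (j : ℕ) : ℝ[X] := C ((j.factorial : ℝ)⁻¹) * descPochhammer ℝ j

theorem binomPoly_eval_natCast (j k : ℕ) : (binomPoly j).eval (k : ℝ) = k.choose j := by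
  have h : (j.factorial : ℝ) ≠ 0 := by exact_mod_cast j.factorial_ne_zero
  rw [binomPoly, eval_mul, eval_C, descPochhammer_eval_eq_descFactorial,
    Nat.descFactorial_eq_factorial_mul_choose]
  push_cast
  field_simp

theorem binomPoly_eval_zero (j : ℕ) : (binomPoly j).eval (0 : ℝ) = if j = 0 then 1 else 0 := by
  have := binomPoly_eval_natCast j 0
  rw [Nat.cast_zero] at this
  rw [this]
  cases j <;> simp

theorem descPochhammer_eval_neg_one (j : ℕ) :
    (descPochhammer ℝ j).eval (-1 : ℝ) = (-1) ^ j * j.factorial := by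
  induction j with
  | zero => simp
  | succ j ih =>
    rw [descPochhammer_succ_right, eval_mul, ih, Nat.factorial_succ]
    simp only [eval_sub, eval_X, eval_natCast]
    push_cast
    ring

theorem binomPoly_derivative_eval_zero (j : ℕ) :
    (derivative (binomPoly j)).eval (0 : ℝ) =
      if j = 0 then 0 else (-1 : ℝ) ^ (j - 1) / j := by
  cases j with
  | zero => simp [binomPoly]
  | succ j =>
    have h : (j.factorial : ℝ) ≠ 0 := by exact_mod_cast j.factorial_ne_zero
    have h' : (j : ℝ) + 1 ≠ 0 := by positivity
    rw [binomPoly, descPochhammer_succ_left]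
    simp only [derivative_mul, derivative_C, derivative_X, eval_add, eval_mul, eval_C, eval_X,
      zero_mul, zero_add, one_mul, eval_comp, eval_sub, eval_one, zero_sub,
      descPochhammer_eval_neg_one, Nat.factorial_succ]
    push_cast
    simp
    field_simp

/-- A linear relation with polynomial coefficients that holds at all natural numbers holds
identically, hence persists when an arbitrary linear functional is applied to the coefficients. -/
theorem sum_functional_smul_eq_zero {U ι : Type*} [AddCommGroup U] [Module ℝ U] (s : Finset ι)
    (P : ι → ℝ[X]) (m : ι → U) (h : ∀ k : ℕ, ∑ i ∈ s, (P i).eval (k : ℝ) • m i = 0)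
    (l : ℝ[X] →ₗ[ℝ] ℝ) : ∑ i ∈ s, l (P i) • m i = 0 := by
  rw [← Module.forall_dual_apply_eq_zero_iff ℝ]
  intro φ
  have h0 : ∑ i ∈ s, φ (m i) • P i = 0 := by
    refine Polynomial.eq_zero_of_infinite_isRoot _ ?_
    refine Set.Infinite.mono ?_ (Set.infinite_range_of_injective (Nat.cast_injective (R := ℝ)))
    rintro _ ⟨k, rfl⟩
    have := congrArg φ (h k)
    simp only [map_sum, map_smul, smul_eq_mul, map_zero] at this
    simp only [Set.mem_ofPred_eq, IsRoot.def, eval_finsetSum, eval_smul, smul_eq_mul]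
    rw [← this]
    exact Finset.sum_congr rfl fun i _ => mul_comm _ _
  have := congrArg l h0
  simp only [map_sum, map_smul, smul_eq_mul, map_zero] at this ⊢
  rw [← this]
  exact Finset.sum_congr rfl fun i _ => mul_comm _ _

theorem sum_functional_smul_eq {U ι κ : Type*} [AddCommGroup U] [Module ℝ U] (s : Finset ι)
    (P : ι → ℝ[X]) (m : ι → U) (t : Finset κ) (Q : κ → ℝ[X]) (n : κ → U)
    (h : ∀ k : ℕ, ∑ i ∈ s, (P i).eval (k : ℝ) • m i = ∑ j ∈ t, (Q j).eval (k : ℝ) • n j)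
    (l : ℝ[X] →ₗ[ℝ] ℝ) : ∑ i ∈ s, l (P i) • m i = ∑ j ∈ t, l (Q j) • n j := by
  have := sum_functional_smul_eq_zero (s.disjSum t) (Sum.elim P Q) (Sum.elim m (fun j => -n j))
    (fun k => by simp [Finset.sum_disjSum, h k]) l
  simpa [Finset.sum_disjSum, ← sub_eq_add_neg, sub_eq_zero] using this

variable {A : Type*} [Ring A] [Algebra ℝ A]

/-- The exponential series, truncated before degree `K`. -/
def texp (K : ℕ) (a : A) : A := ∑ i ∈ Finset.range K, ((i.factorial : ℝ)⁻¹) • a ^ i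

/-- The series of `log (1 + n)`, truncated before degree `K`. -/
def unipLog (K : ℕ) (n : A) : A :=
  ∑ j ∈ Finset.range K, (if j = 0 then (0 : ℝ) else (-1 : ℝ) ^ (j - 1) / j) • n ^ j

theorem map_texp {B F : Type*} [Ring B] [Algebra ℝ B] [FunLike F A B] [AlgHomClass F ℝ A B]
    (f : F) (K : ℕ) (a : A) : f (texp K a) = texp K (f a) := by
  simp [texp]

theorem map_unipLog {B F : Type*} [Ring B] [Algebra ℝ B] [FunLike F A B] [AlgHomClass F ℝ A B]
    (f : F) (K : ℕ) (a : A) : f (unipLog K a) = unipLog K (f a) := by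
  simp only [unipLog, map_sum, map_smul, map_pow]

theorem sum_range_eq_of_pow_eq_zero {n : A} {K L : ℕ} (hn : n ^ K = 0) (hKL : K ≤ L)
    (c : ℕ → ℝ) : ∑ i ∈ Finset.range L, c i • n ^ i = ∑ i ∈ Finset.range K, c i • n ^ i := by
  refine (Finset.sum_subset (Finset.range_mono hKL) fun i _ hi => ?_).symm
  rw [pow_eq_zero_of_le (by simpa using hi) hn, smul_zero]

theorem texp_eq_of_le {n : A} {K L : ℕ} (hn : n ^ K = 0) (hKL : K ≤ L) :
    texp L n = texp K n := sum_range_eq_of_pow_eq_zero hn hKL _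

theorem one_add_pow_eq_sum (n : A) {K : ℕ} (hn : n ^ K = 0) (k : ℕ) :
    (1 + n) ^ k = ∑ j ∈ Finset.range K, (binomPoly j).eval (k : ℝ) • n ^ j := by
  rw [← sum_range_eq_of_pow_eq_zero hn (le_max_left K (k + 1)), add_comm,
    (Commute.one_right n).add_pow]
  simp only [one_pow, mul_one]
  refine (Finset.sum_subset (Finset.range_mono (le_max_right K (k + 1))) ?_).trans ?_
  · intro j _ hj
    rw [Nat.choose_eq_zero_of_lt (by simpa using hj)]
    simp
  · refine Finset.sum_congr rfl fun j _ => ?_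
    rw [binomPoly_eval_natCast, Nat.cast_smul_eq_nsmul, nsmul_eq_mul, Nat.cast_comm]

/-- The functional `p ↦ p'(0)`. It turns `s ↦ (1 + n)ˢ` into `log (1 + n)`. -/
def derivZero : ℝ[X] →ₗ[ℝ] ℝ := leval 0 ∘ₗ derivative

theorem derivZero_apply (p : ℝ[X]) : derivZero p = (derivative p).eval 0 := rfl

theorem sum_derivZero_binomPoly (K : ℕ) (n : A) :
    ∑ j ∈ Finset.range K, derivZero (binomPoly j) • n ^ j = unipLog K n := by
  simp only [derivZero_apply, binomPoly_derivative_eval_zero, unipLog]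

section Rat

/-- The restriction of scalars of a real vector space to `ℚ`, the field over which Mathlib's
`IsNilpotent.exp` is defined. -/
abbrev ratModule (A : Type*) [AddCommGroup A] [Module ℝ A] : Module ℚ A :=
  Module.compHom A (algebraMap ℚ ℝ)

theorem texp_eq_exp {a : A} {K : ℕ} (ha : a ^ K = 0) :
    texp K a = @IsNilpotent.exp A _ (ratModule A) a := by
  let _ := ratModule A
  rw [IsNilpotent.exp_eq_sum ha]
  refine Finset.sum_congr rfl fun i _ => ?_
  change _ = (algebraMap ℚ ℝ (i.factorial : ℚ)⁻¹) • a ^ i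
  simp

end Rat

theorem texp_add {a b : A} {K : ℕ} (hab : Commute a b) (ha : a ^ K = 0) (hb : b ^ K = 0)
    (hc : (a + b) ^ K = 0) : texp K (a + b) = texp K a * texp K b := by
  let _ := ratModule A
  rw [texp_eq_exp ha, texp_eq_exp hb, texp_eq_exp hc,
    IsNilpotent.exp_add_of_commute hab ⟨K, ha⟩ ⟨K, hb⟩]

theorem texp_zero {K : ℕ} (hK : K ≠ 0) : texp K (0 : A) = 1 := by
  obtain ⟨k, rfl⟩ := Nat.exists_eq_succ_of_ne_zero hK
  simp [texp, Finset.sum_range_succ']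

theorem neg_pow_eq_zero {A : Type*} [Ring A] {a : A} {K : ℕ} (ha : a ^ K = 0) : (-a) ^ K = 0 := by
  rw [neg_pow, ha, mul_zero]

theorem texp_mul_texp_neg {a : A} {K : ℕ} (ha : a ^ K = 0) (hK : K ≠ 0) :
    texp K a * texp K (-a) = 1 := by
  have := texp_add (b := -a) (Commute.refl a).neg_right ha (neg_pow_eq_zero ha)
    (by simp [hK])
  rw [← this, add_neg_cancel, texp_zero hK]

theorem texp_neg_mul_texp {a : A} {K : ℕ} (ha : a ^ K = 0) (hK : K ≠ 0) :
    texp K (-a) * texp K a = 1 := by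
  simpa using texp_mul_texp_neg (neg_pow_eq_zero ha) hK

theorem texp_natCast_smul {a : A} {K : ℕ} (ha : a ^ K = 0) (hK : K ≠ 0) (k : ℕ) :
    texp K ((k : ℝ) • a) = texp K a ^ k := by
  have h (c : ℝ) : (c • a) ^ K = 0 := by rw [_root_.smul_pow, ha, smul_zero]
  induction k with
  | zero => simp [texp_zero hK]
  | succ k ih =>
    rw [Nat.cast_succ, add_smul, one_smul, texp_add ((Commute.refl a).smul_left _) (h _) ha
      (by have := h (k + 1); rwa [add_smul, one_smul] at this), ih, pow_succ]

theorem texp_sub_one_pow {a : A} {K : ℕ} (ha : a ^ K = 0) : (texp K a - 1) ^ K = 0 := by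
  rcases Nat.eq_zero_or_pos K with rfl | hK
  · exact (pow_zero _).trans ((pow_zero a).symm.trans ha)
  obtain ⟨k, rfl⟩ := Nat.exists_eq_succ_of_ne_zero hK.ne'
  have : texp (k + 1) a - 1 =
      a * ∑ i ∈ Finset.range k, (((i + 1).factorial : ℝ)⁻¹) • a ^ i := by
    rw [texp, Finset.sum_range_succ', Finset.mul_sum]
    simp [pow_succ']
  have hc : Commute a (∑ i ∈ Finset.range k, (((i + 1).factorial : ℝ)⁻¹) • a ^ i) :=
    Commute.sum_right _ _ _ fun i _ => ((Commute.refl a).pow_right i).smul_right _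
  rw [this, hc.mul_pow, ha, zero_mul]

/-- The logarithm inverts the exponential: both sides are the derivative at `s = 0` of
`s ↦ exp (s a)`. -/
theorem unipLog_texp_sub_one {a : A} {K : ℕ} (ha : a ^ K = 0) (hK : 2 ≤ K) :
    unipLog K (texp K a - 1) = a := by
  have key := sum_functional_smul_eq (Finset.range K) binomPoly (fun j => (texp K a - 1) ^ j)
    (Finset.range K) (fun i => X ^ i) (fun i => ((i.factorial : ℝ)⁻¹) • a ^ i) (fun k => by
      rw [← one_add_pow_eq_sum _ (texp_sub_one_pow ha), add_sub_cancel,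
        ← texp_natCast_smul ha (by omega), texp]
      refine Finset.sum_congr rfl fun i _ => ?_
      rw [_root_.smul_pow, eval_pow, eval_X, smul_comm]) derivZero
  rw [sum_derivZero_binomPoly] at key
  rw [key, Finset.sum_eq_single 1]
  · simp [derivZero_apply]
  · intro i _ hi
    rcases Nat.eq_zero_or_pos i with rfl | hi0
    · simp [derivZero_apply]
    · rw [derivZero_apply, derivative_X_pow, eval_mul, eval_pow, eval_X,
        zero_pow (by omega), mul_zero, zero_smul]
  · intro h
    simp at h
    omega

/-- The exponential inverts the logarithm: `s ↦ (1 + n)ˢ` is a polynomial solution of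
`p' = log (1 + n) p`, so that its Taylor expansion at `0` is the exponential series. -/
theorem texp_unipLog {n : A} {K : ℕ} (hn : n ^ K = 0) :
    texp K (unipLog K n) = 1 + n := by
  set Z := unipLog K n with hZ
  let S : (ℝ[X] →ₗ[ℝ] ℝ) → A := fun l => ∑ j ∈ Finset.range K, l (binomPoly j) • n ^ j
  have hS1 : ∀ k : ℕ, S (leval (k : ℝ)) = (1 + n) ^ k := fun k =>
    (one_add_pow_eq_sum n hn k).symm
  have hstep0 : ∀ k : ℕ, S (leval (k : ℝ) ∘ₗ derivative) = Z * S (leval (k : ℝ)) := by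
    intro k
    have := sum_functional_smul_eq (Finset.range K)
      (fun j => (binomPoly j).comp (X + Polynomial.C (k : ℝ))) (fun j => n ^ j) (Finset.range K)
      binomPoly (fun j => n ^ j * (1 + n) ^ k) (fun l => by
        simp only [← smul_mul_assoc]
        rw [← Finset.sum_mul, ← one_add_pow_eq_sum n hn l, ← pow_add,
          one_add_pow_eq_sum n hn (l + k)]
        simp) derivZero
    simp only [← smul_mul_assoc] at this
    rw [← Finset.sum_mul, sum_derivZero_binomPoly, ← hZ] at this
    rw [hS1, ← this]
    simp [S, derivZero_apply, derivative_comp]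
  have hstep : ∀ l : ℝ[X] →ₗ[ℝ] ℝ, S (l ∘ₗ derivative) = Z * S l := by
    intro l
    have := sum_functional_smul_eq (Finset.range K) (fun j => derivative (binomPoly j))
      (fun j => n ^ j) (Finset.range K) binomPoly (fun j => Z * n ^ j) (fun k => by
        have := hstep0 k
        simp only [S, Finset.mul_sum, mul_smul_comm] at this
        exact this) l
    simp only [S, Finset.mul_sum, mul_smul_comm]
    exact this
  have hiter : ∀ i, S (leval 0 ∘ₗ (derivative (R := ℝ)) ^ i) = Z ^ i := by
    intro i
    induction i with
    | zero =>
      have := hS1 0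
      rw [Nat.cast_zero, pow_zero] at this
      rw [pow_zero, pow_zero]
      exact this
    | succ i ih =>
      rw [pow_succ, pow_succ', ← ih, ← hstep]
      rfl
  -- Taylor's formula at `0`
  have h1 : ∀ p : ℝ[X], p.natDegree < K → p.eval 1 =
      ∑ i ∈ Finset.range K, ((i.factorial : ℝ)⁻¹) * (leval 0 ∘ₗ (derivative (R := ℝ)) ^ i) p := by
    intro p hp
    rw [eval_eq_sum_range' hp]
    refine Finset.sum_congr rfl fun i _ => ?_
    have h : (i.factorial : ℝ) ≠ 0 := by exact_mod_cast i.factorial_ne_zero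
    rw [LinearMap.comp_apply, leval_apply, Module.End.pow_apply, ← coeff_zero_eq_eval_zero,
      coeff_iterate_derivative]
    simp [Nat.descFactorial_self]
    field_simp
  have hdeg : ∀ j, (binomPoly j).natDegree ≤ j := fun j =>
    (natDegree_C_mul_le _ _).trans (descPochhammer_natDegree ℝ j).le
  have h2 : S (leval 1) = texp K Z := by
    simp only [texp, ← hiter, S, Finset.smul_sum]
    rw [Finset.sum_comm]
    refine Finset.sum_congr rfl fun j hj => ?_
    rw [leval_apply, h1 _ ((hdeg j).trans_lt (by simpa using hj)), Finset.sum_smul]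
    simp only [mul_smul]
  rw [← h2]
  have := hS1 1
  rwa [Nat.cast_one, pow_one] at this

/-- If conjugation by powers of `1 + n` acts on `e` through powers of `1 + ν`, then the commutator
with `log (1 + n)` acts on `e` through `log (1 + ν)`. -/
theorem lie_unipLog_of_conj {n e : A} {K : ℕ} (hn : n ^ K = 0) (ν : A →ₗ[ℝ] A)
    (hν : (ν ^ K) e = 0) (h : ∀ k : ℕ, ((1 + ν) ^ k) e * (1 + n) ^ k = (1 + n) ^ k * e) :
    unipLog K n * e - e * unipLog K n = unipLog K ν e := by
  have hpow : ∀ k : ℕ, ((1 + ν) ^ k) e =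
      ∑ j ∈ Finset.range K, (binomPoly j).eval (k : ℝ) • (ν ^ j) e := by
    intro k
    rw [add_comm, (Commute.one_right ν).add_pow]
    simp only [one_pow, mul_one, LinearMap.sum_apply]
    have h0 : ∀ j, K ≤ j → (ν ^ j) e = 0 := fun j hj => by
      rw [← Nat.sub_add_cancel hj, pow_add, Module.End.mul_apply, hν, map_zero]
    have hterm : ∀ j, (ν ^ j * (k.choose j : Module.End ℝ A)) e =
        (binomPoly j).eval (k : ℝ) • (ν ^ j) e := fun j => by
      rw [binomPoly_eval_natCast, ← Nat.cast_comm, ← nsmul_eq_mul, LinearMap.smul_apply,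
        Nat.cast_smul_eq_nsmul]
    simp only [hterm]
    trans ∑ j ∈ Finset.range (max K (k + 1)), (binomPoly j).eval (k : ℝ) • (ν ^ j) e
    · refine Finset.sum_subset (Finset.range_mono (le_max_right K (k + 1))) fun j _ hj => ?_
      rw [binomPoly_eval_natCast, Nat.choose_eq_zero_of_lt (by simpa using hj)]
      simp
    · refine (Finset.sum_subset (Finset.range_mono (le_max_left K (k + 1))) fun j _ hj => ?_).symm
      rw [h0 j (by simpa using hj), smul_zero]
  have key := sum_functional_smul_eq (Finset.range K ×ˢ Finset.range K)
    (fun q => binomPoly q.1 * binomPoly q.2) (fun q => (ν ^ q.1) e * n ^ q.2) (Finset.range K)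
    binomPoly (fun j => n ^ j * e) (fun k => by
      have := h k
      rw [hpow, one_add_pow_eq_sum n hn, Finset.sum_mul_sum, Finset.sum_mul] at this
      rw [Finset.sum_product]
      simp only [smul_mul_smul_comm] at this
      simpa only [eval_mul, smul_mul_assoc] using this) derivZero
  simp only [← smul_mul_assoc] at key
  rw [← Finset.sum_mul, sum_derivZero_binomPoly] at key
  rw [← key, Finset.sum_product]
  rcases Nat.eq_zero_or_pos K with rfl | hK
  · simp [unipLog]
  -- the product rule at `0`, where the binomial polynomials other than the first one vanish
  have hd : ∀ i j, derivZero (binomPoly i * binomPoly j) =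
      derivZero (binomPoly i) * (if j = 0 then 1 else 0) +
        (if i = 0 then 1 else 0) * derivZero (binomPoly j) := by
    intro i j
    simp only [derivZero_apply, derivative_mul, eval_add, eval_mul, binomPoly_eval_zero]
  have h0K : 0 ∈ Finset.range K := Finset.mem_range.2 hK
  simp only [hd, add_smul, Finset.sum_add_distrib, add_mul, mul_ite, ite_mul, mul_one, one_mul,
    mul_zero, zero_mul, ite_smul, zero_smul, Finset.sum_ite_eq', h0K, if_true]
  rw [Finset.sum_comm (s := Finset.range K)]
  simp only [Finset.sum_ite_eq', h0K, if_true, pow_zero, mul_one]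
  have e1 : ∑ j ∈ Finset.range K, (derivZero (binomPoly j) • (1 : Module.End ℝ A) e) * n ^ j =
      e * unipLog K n := by
    rw [← sum_derivZero_binomPoly, Finset.mul_sum]
    simp
  have e2 : ∑ j ∈ Finset.range K, derivZero (binomPoly j) • (ν ^ j) e = unipLog K ν e := by
    rw [← sum_derivZero_binomPoly]
    simp [LinearMap.sum_apply]
  rw [e1, e2]
  abel

end TruncatedExpLog

/-! ### Dynkin's formula in associative algebras -/

section Words

variable {L : Type*}

theorem dynkinWord_zero (r s : Fin 0 → ℕ) (u v : L) : dynkinWord r s u v = [] := rfl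

theorem dynkinWord_succ {k : ℕ} (r s : Fin (k + 1) → ℕ) (u v : L) :
    dynkinWord r s u v = List.replicate (r 0) u ++ List.replicate (s 0) v ++
      dynkinWord (fun i => r i.succ) (fun i => s i.succ) u v := by
  simp [dynkinWord, List.ofFn_succ]

theorem dynkinWord_length {k : ℕ} (r s : Fin k → ℕ) (u v : L) :
    (dynkinWord r s u v).length = ∑ i, (r i + s i) := by
  induction k with
  | zero => rfl
  | succ k ih => simp [dynkinWord_succ, ih, Fin.sum_univ_succ, add_assoc]

theorem dynkinWord_map {L' : Type*} (f : L → L') {k : ℕ} (r s : Fin k → ℕ) (u v : L) :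
    (dynkinWord r s u v).map f = dynkinWord r s (f u) (f v) := by
  induction k with
  | zero => rfl
  | succ k ih => simp [dynkinWord_succ, ih]

theorem nestedBracket_cons [LieRing L] (a : L) {l : List L} (hl : l ≠ []) :
    nestedBracket (a :: l) = ⁅a, nestedBracket l⁆ := by
  obtain ⟨b, l, rfl⟩ := List.exists_cons_of_ne_nil hl
  rfl

theorem map_nestedBracket {L' F : Type*} [LieRing L] [LieRing L'] [FunLike F L L']
    [AddMonoidHomClass F L L'] (f : F) (hf : ∀ a b, f ⁅a, b⁆ = ⁅f a, f b⁆) (l : List L) :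
    f (nestedBracket l) = nestedBracket (l.map f) := by
  induction l with
  | nil => exact map_zero f
  | cons a l ih =>
    rcases eq_or_ne l [] with rfl | hl
    · rfl
    · rw [nestedBracket_cons a hl, hf, ih, List.map_cons, nestedBracket_cons _ (by simpa using hl)]

theorem nestedBracket_map_neg [LieRing L] [LieAlgebra ℝ L] (l : List L) :
    nestedBracket (l.map Neg.neg) = ((-1 : ℝ) ^ l.length) • nestedBracket l := by
  induction l with
  | nil => simp [nestedBracket]
  | cons a l ih =>
    rcases eq_or_ne l [] with rfl | hl
    · simp [nestedBracket]
    · rw [nestedBracket_cons a hl, List.map_cons, nestedBracket_cons _ (by simpa using hl), ih,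
        neg_lie, lie_smul, List.length_cons, pow_succ, mul_neg_one, neg_smul]

variable [LieRing L] [LieAlgebra ℝ L]

/-- The coefficient of the word `u^{r₁} v^{s₁} ⋯ u^{rₖ} v^{sₖ}` in `(exp u exp v - 1)ᵏ`. -/
def dynkinCoeff {k n : ℕ} (r s : Fin k → Fin n) : ℝ :=
  ∏ i, (((r i : ℕ).factorial : ℝ)⁻¹ * ((s i : ℕ).factorial : ℝ)⁻¹)

/-- Dynkin's series for `log (exp u exp v)`, truncated to the words that can be nonzero when all
brackets of more than `N` letters vanish. -/
def dynkinSeries (N : ℕ) (u v : L) : L :=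
  ∑ k ∈ Finset.Icc 1 N, ∑ r : Fin k → Fin (N + 1), ∑ s : Fin k → Fin (N + 1),
    if ∀ i, 0 < (r i : ℕ) + s i then
      (((-1 : ℝ) ^ (k - 1) / k) * (((∑ i, ((r i : ℕ) + s i) : ℕ) : ℝ)⁻¹ * dynkinCoeff r s)) •
        nestedBracket (dynkinWord (fun i => (r i : ℕ)) (fun i => (s i : ℕ)) u v)
    else 0

theorem map_dynkinSeries {L' F : Type*} [LieRing L'] [LieAlgebra ℝ L'] [FunLike F L L']
    [LinearMapClass F ℝ L L'] (f : F) (hf : ∀ a b, f ⁅a, b⁆ = ⁅f a, f b⁆) (N : ℕ) (x y : L) :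
    f (dynkinSeries N x y) = dynkinSeries N (f x) (f y) := by
  simp only [dynkinSeries, map_sum]
  refine Finset.sum_congr rfl fun k _ => Finset.sum_congr rfl fun r _ =>
    Finset.sum_congr rfl fun s _ => ?_
  split_ifs
  · rw [map_smul, map_nestedBracket f hf, dynkinWord_map]
  · exact map_zero f

theorem nestedBracket_mem (K : LieSubalgebra ℝ L) (l : List L) (hl : ∀ a ∈ l, a ∈ K) :
    nestedBracket l ∈ K := by
  induction l with
  | nil => exact K.zero_mem
  | cons a l ih =>
    rcases eq_or_ne l [] with rfl | hne
    · exact hl a (by simp)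
    · rw [nestedBracket_cons _ hne]
      exact K.lie_mem (hl a (by simp)) (ih fun b hb => hl b (by simp [hb]))

theorem bchMul_mem (K : LieSubalgebra ℝ L) (N : ℕ) {u v : L} (hu : u ∈ K) (hv : v ∈ K) :
    bchMul N u v ∈ K := by
  refine sum_mem fun k _ => sum_mem fun r _ => sum_mem fun s _ => ?_
  split_ifs
  · refine K.smul_mem _ (nestedBracket_mem K _ fun a ha => ?_)
    simp only [dynkinWord, List.mem_flatten, List.mem_ofFn] at ha
    obtain ⟨_, ⟨i, rfl⟩, ha⟩ := ha
    rcases List.mem_append.1 ha with h | h <;> rw [List.eq_of_mem_replicate h] <;> assumption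
  · exact K.zero_mem

/-- The product for right-invariant fields and the one for left-invariant fields correspond to
each other under `u ↦ -u`. -/
theorem bchMul_eq (N : ℕ) (u v : L) : bchMul N u v = -dynkinSeries N (-u) (-v) := by
  simp only [bchMul, dynkinSeries, ← Finset.sum_neg_distrib]
  refine Finset.sum_congr rfl fun k hk => Finset.sum_congr rfl fun r _ =>
    Finset.sum_congr rfl fun s _ => ?_
  split_ifs with h
  swap
  · simp
  rw [← dynkinWord_map, nestedBracket_map_neg, dynkinWord_length, smul_smul, ← neg_smul]
  congr 1
  have hk1 : 1 ≤ k := (Finset.mem_Icc.1 hk).1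
  have hm : 1 ≤ ∑ i, ((r i : ℕ) + s i) := by
    refine (Nat.succ_le_of_lt (h ⟨0, hk1⟩)).trans ?_
    exact Finset.single_le_sum (f := fun i => (r i : ℕ) + s i) (fun _ _ => Nat.zero_le _)
      (Finset.mem_univ _)
  obtain ⟨m, hm'⟩ := Nat.exists_eq_add_of_le' hm
  simp only [hm', dynkinCoeff, Finset.prod_mul_distrib, Finset.prod_inv_distrib, pow_succ,
    Nat.add_sub_cancel]
  field_simp

end Words

section Associative

variable {A : Type*} [Ring A] [Algebra ℝ A]

attribute [local instance] LieRing.ofAssociativeRing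

/-- All words of more than `N` letters `x`, `y` vanish. -/
def WordsVanish (N : ℕ) (x y : A) : Prop :=
  ∀ w : List Bool, N < w.length → (w.map fun b => bif b then x else y).prod = 0

theorem dynkinWord_eq_map {L : Type*} {k : ℕ} (r s : Fin k → ℕ) (x y : L) :
    dynkinWord r s x y = (dynkinWord r s true false).map fun b => bif b then x else y := by
  rw [dynkinWord_map]; rfl

theorem WordsVanish.pow_left {A : Type*} [Ring A] {N : ℕ} {x y : A} (h : WordsVanish N x y) :
    x ^ (N + 1) = 0 := by
  simpa using h (List.replicate (N + 1) true) (by simp)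

theorem WordsVanish.pow_right {A : Type*} [Ring A] {N : ℕ} {x y : A} (h : WordsVanish N x y) :
    y ^ (N + 1) = 0 := by
  simpa using h (List.replicate (N + 1) false) (by simp)

theorem le_sum_of_pos {k : ℕ} {r s : Fin k → ℕ} (h : ∀ i, 0 < r i + s i) :
    k ≤ ∑ i, (r i + s i) := by
  simpa using Finset.card_nsmul_le_sum Finset.univ (fun i => r i + s i) 1
    (fun i _ => Nat.succ_le_of_lt (h i))

theorem texp_mul_texp_sub_one (N : ℕ) (x y : A) :
    texp (N + 1) x * texp (N + 1) y - 1 = ∑ r : Fin (N + 1), ∑ s : Fin (N + 1),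
      if 0 < (r : ℕ) + s then
        (((r : ℕ).factorial : ℝ)⁻¹ * ((s : ℕ).factorial : ℝ)⁻¹) • (x ^ (r : ℕ) * y ^ (s : ℕ))
      else 0 := by
  have h : texp (N + 1) x * texp (N + 1) y = ∑ r : Fin (N + 1), ∑ s : Fin (N + 1),
      (((r : ℕ).factorial : ℝ)⁻¹ * ((s : ℕ).factorial : ℝ)⁻¹) •
        (x ^ (r : ℕ) * y ^ (s : ℕ)) := by
    simp only [texp, Finset.sum_range, Finset.sum_mul_sum, smul_mul_smul_comm]
  have h1 : (1 : A) = ∑ r : Fin (N + 1), ∑ s : Fin (N + 1),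
      if (r = 0 ∧ s = 0) then (1 : A) else 0 := by
    simp [ite_and]
  rw [h]
  conv_lhs => rw [h1]
  simp only [← Finset.sum_sub_distrib]
  refine Finset.sum_congr rfl fun r _ => Finset.sum_congr rfl fun s _ => ?_
  by_cases hrs : r = 0 ∧ s = 0
  · simp [hrs.1, hrs.2]
  · rw [if_neg hrs, if_pos, sub_zero]
    by_contra h0
    exact hrs ⟨Fin.ext (show (r : ℕ) = 0 by omega), Fin.ext (show (s : ℕ) = 0 by omega)⟩

/-- The expansion into words of the powers in the series of `log (exp x exp y)`. -/
theorem texp_mul_texp_sub_one_pow (N : ℕ) (x y : A) (k : ℕ) :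
    (texp (N + 1) x * texp (N + 1) y - 1) ^ k =
      ∑ r : Fin k → Fin (N + 1), ∑ s : Fin k → Fin (N + 1),
        if ∀ i, 0 < (r i : ℕ) + s i then
          dynkinCoeff r s •
            (dynkinWord (fun i => (r i : ℕ)) (fun i => (s i : ℕ)) x y).prod
        else 0 := by
  induction k with
  | zero => simp [dynkinCoeff, dynkinWord_zero]
  | succ k ih =>
    rw [pow_succ', ih, texp_mul_texp_sub_one,
      ← Equiv.sum_comp (Fin.consEquiv fun _ => Fin (N + 1)), Fintype.sum_prod_type,
      Finset.sum_mul_sum]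
    refine Finset.sum_congr rfl fun r0 _ => Finset.sum_congr rfl fun r _ => ?_
    rw [← Equiv.sum_comp (Fin.consEquiv fun _ => Fin (N + 1)), Fintype.sum_prod_type,
      Finset.sum_mul_sum]
    refine Finset.sum_congr rfl fun s0 _ => Finset.sum_congr rfl fun s _ => ?_
    simp only [Fin.consEquiv_apply, Fin.forall_fin_succ, Fin.cons_zero, Fin.cons_succ,
      dynkinCoeff, Fin.prod_univ_succ, dynkinWord_succ, List.prod_append, List.prod_replicate]
    by_cases h0 : 0 < (r0 : ℕ) + s0
    · by_cases h1 : ∀ i, 0 < (r i : ℕ) + s i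
      · rw [if_pos h0, if_pos h1, if_pos ⟨h0, h1⟩, smul_mul_smul_comm]
      · rw [if_neg h1, mul_zero, if_neg (fun h : _ ∧ _ => h1 h.2)]
    · rw [if_neg h0, zero_mul, if_neg (fun h : _ ∧ _ => h0 h.1)]

theorem WordsVanish.pow_eq_zero {N : ℕ} {x y : A} (h : WordsVanish N x y) :
    (texp (N + 1) x * texp (N + 1) y - 1) ^ (N + 1) = 0 := by
  rw [texp_mul_texp_sub_one_pow]
  refine Finset.sum_eq_zero fun r _ => Finset.sum_eq_zero fun s _ => ?_
  split_ifs with hrs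
  · rw [dynkinWord_eq_map, h, smul_zero]
    rw [dynkinWord_length]
    exact Nat.lt_of_succ_le (le_sum_of_pos hrs)
  · rfl

/-- The adjoint action of `exp x` is the exponential of the adjoint action of `x`. -/
theorem texp_mul_mul_texp_neg {K : ℕ} {x : A} (hx : x ^ K = 0) (e : A)
    (he : ∀ r, K ≤ r → ((LieAlgebra.ad ℝ A x : Module.End ℝ A) ^ r) e = 0) :
    texp K x * e * texp K (-x) = texp K (LieAlgebra.ad ℝ A x : Module.End ℝ A) e := by
  let l : Module.End ℝ A := LinearMap.mulLeft ℝ x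
  let r : Module.End ℝ A := LinearMap.mulRight ℝ x
  have hL' : l ^ K = 0 := by
    rw [LinearMap.pow_mulLeft, hx, LinearMap.mulLeft_zero_eq_zero]
  have hR' : (-r) ^ K = 0 := by
    refine neg_pow_eq_zero ?_
    rw [LinearMap.pow_mulRight, hx, LinearMap.mulRight_zero_eq_zero]
  have hL : l ^ (K + K) = 0 := pow_eq_zero_of_le (by omega) hL'
  have hR : (-r) ^ (K + K) = 0 := pow_eq_zero_of_le (by omega) hR'
  have hc : Commute l (-r) := Commute.neg_right
    (LinearMap.ext fun a => (mul_assoc x a x).symm)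
  have had : (LieAlgebra.ad ℝ A x : Module.End ℝ A) = l + -r := by
    rw [LieAlgebra.ad_eq_lmul_left_sub_lmul_right, sub_eq_add_neg]
    rfl
  have h1 := texp_add hc hL hR (hc.add_pow_eq_zero_of_add_le_succ_of_pow_eq_zero hL' hR' (by omega))
  rw [← had, texp_eq_of_le hL' (by omega), texp_eq_of_le hR' (by omega)] at h1
  have h2 : texp (K + K) (LieAlgebra.ad ℝ A x : Module.End ℝ A) e =
      texp K (LieAlgebra.ad ℝ A x : Module.End ℝ A) e := by
    simp only [texp, LinearMap.sum_apply, LinearMap.smul_apply]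
    refine (Finset.sum_subset (Finset.range_mono (by omega)) fun r _ hr => ?_).symm
    rw [he r (by simpa using hr), smul_zero]
  rw [← h2, h1]
  have h3 : texp K l = LinearMap.mulLeft ℝ (texp K x) := by
    ext a
    simp [l, texp, LinearMap.sum_apply, LinearMap.pow_mulLeft, Finset.sum_mul]
  have h4 : texp K (-r) = LinearMap.mulRight ℝ (texp K (-x)) := by
    have : -r = LinearMap.mulRight ℝ (-x) := by
      ext a
      simp [r]
    rw [this]
    ext a
    simp [texp, LinearMap.sum_apply, LinearMap.pow_mulRight, Finset.mul_sum]
  rw [h3, h4, Module.End.mul_apply, LinearMap.mulLeft_apply, LinearMap.mulRight_apply, mul_assoc]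

theorem WordsVanish.nestedBracket_eq_zero {A : Type*} [Ring A] {N : ℕ} {x y : A}
    (h : WordsVanish N x y) {w : List Bool} (hw : N < w.length) :
    nestedBracket (w.map fun b => bif b then x else y) = 0 := by
  set f : Bool → A := fun b => bif b then x else y
  have key : ∀ w w1 w2 : List Bool, N < w1.length + w.length + w2.length →
      (w1.map f).prod * nestedBracket (w.map f) * (w2.map f).prod = 0 := by
    intro w
    induction w with
    | nil => intros; simp [nestedBracket]
    | cons b w ih =>
      intro w1 w2 hN
      rcases eq_or_ne w [] with rfl | hl
      · have := h (w1 ++ [b] ++ w2) (by simp at hN ⊢; omega)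
        simpa [nestedBracket, f, mul_assoc] using this
      · rw [List.map_cons, nestedBracket_cons _ (by simpa using hl),
          LieRing.of_associative_ring_bracket]
        have e1 := ih (w1 ++ [b]) w2 (by simp at hN ⊢; omega)
        have e2 := ih w1 (b :: w2) (by simp at hN ⊢; omega)
        simp only [List.map_append, List.map_cons, List.map_nil, List.prod_append, List.prod_cons,
          List.prod_nil, mul_one] at e1 e2
        rw [mul_sub, sub_mul]
        simp only [mul_assoc] at e1 e2 ⊢
        rw [e1, e2, sub_zero]
  simpa using key w [] [] (by simpa using hw)

theorem prod_ad_apply_eq_neg_nestedBracket {θ : A} (l : List A)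
    (hl : ∀ a ∈ l, θ * a - a * θ = a) (h0 : l ≠ []) :
    (l.map fun a => (LieAlgebra.ad ℝ A a : Module.End ℝ A)).prod θ = -nestedBracket l := by
  induction l with
  | nil => exact absurd rfl h0
  | cons a l ih =>
    have ha := hl a (by simp)
    rw [List.map_cons, List.prod_cons, Module.End.mul_apply]
    rcases eq_or_ne l [] with rfl | hne
    · simp only [List.map_nil, List.prod_nil, Module.End.one_apply, LieAlgebra.ad_apply,
        LieRing.of_associative_ring_bracket, nestedBracket]
      nth_rewrite 3 [← ha]
      abel
    · rw [ih (fun b hb => hl b (by simp [hb])) hne, nestedBracket_cons _ hne, LieAlgebra.ad_apply,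
        lie_neg]

theorem lie_nestedBracket_eq_length_smul {θ : A} (l : List A)
    (hl : ∀ a ∈ l, θ * a - a * θ = a) :
    ⁅θ, nestedBracket l⁆ = (l.length : ℝ) • nestedBracket l := by
  induction l with
  | nil => simp [nestedBracket]
  | cons a l ih =>
    have ha : ⁅θ, a⁆ = a := hl a (by simp)
    rcases eq_or_ne l [] with rfl | hne
    · simp [nestedBracket, ha]
    · rw [nestedBracket_cons _ hne, leibniz_lie, ha, ih (fun b hb => hl b (by simp [hb])), lie_smul,
        List.length_cons]
      push_cast
      rw [add_smul, one_smul, add_comm]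

theorem lie_prod_eq_length_smul {θ : A} (l : List A)
    (hl : ∀ a ∈ l, θ * a - a * θ = a) : ⁅θ, l.prod⁆ = (l.length : ℝ) • l.prod := by
  induction l with
  | nil => simp [LieRing.of_associative_ring_bracket]
  | cons a l ih =>
    have ha := hl a (by simp)
    have ih := ih (fun b hb => hl b (by simp [hb]))
    rw [LieRing.of_associative_ring_bracket] at ih ⊢
    rw [List.prod_cons, List.length_cons]
    push_cast
    rw [add_smul, one_smul, ← mul_smul_comm, ← ih]
    have hb : a * l.prod = (θ * a - a * θ) * l.prod := by rw [ha]
    conv_rhs => rw [hb]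
    noncomm_ring

/-- Dynkin's formula in the presence of an element `θ` whose adjoint action counts letters. Both
sides have the same commutator with `θ`, and both are combinations of words of positive length, on
which the adjoint action of `θ` is injective. -/
theorem unipLog_eq_dynkinSeries_of_grading {N : ℕ} {x y θ : A} (h : WordsVanish N x y)
    (hx : θ * x - x * θ = x) (hy : θ * y - y * θ = y) :
    unipLog (N + 1) (texp (N + 1) x * texp (N + 1) y - 1) = dynkinSeries N x y := by
  set n := texp (N + 1) x * texp (N + 1) y - 1 with hn
  let P : Module.End ℝ A := LieAlgebra.ad ℝ A x
  let Q : Module.End ℝ A := LieAlgebra.ad ℝ A y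
  let ν : Module.End ℝ A := texp (N + 1) P * texp (N + 1) Q - 1
  have hletters : ∀ {k : ℕ} (r s : Fin k → ℕ), ∀ a ∈ dynkinWord r s x y,
      θ * a - a * θ = a := by
    intro k r s a ha
    rw [dynkinWord_eq_map, List.mem_map] at ha
    obtain ⟨b, -, rfl⟩ := ha
    cases b
    exacts [hy, hx]
  -- the elements killed by all words of more than `N` letters `ad x`, `ad y`
  let S : Submodule ℝ A :=
    { carrier := {e | ∀ w : List Bool, N < w.length →
        (w.map fun b => bif b then P else Q).prod e = 0}
      add_mem' := fun ha hb w hw => by rw [map_add, ha w hw, hb w hw, add_zero]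
      zero_mem' := fun w _ => map_zero _
      smul_mem' := fun c a ha w hw => by rw [map_smul, ha w hw, smul_zero] }
  have hSP : ∀ e ∈ S, P e ∈ S := fun e he w hw => by
    simpa using he (w ++ [true]) (by simp; omega)
  have hSQ : ∀ e ∈ S, Q e ∈ S := fun e he w hw => by
    simpa using he (w ++ [false]) (by simp; omega)
  have hStexp : ∀ R : Module.End ℝ A, (∀ e ∈ S, R e ∈ S) → ∀ e ∈ S, texp (N + 1) R e ∈ S := by
    intro R hR e he
    have hp : ∀ i, (R ^ i) e ∈ S := by
      intro i
      induction i with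
      | zero => exact he
      | succ i ih => rw [pow_succ', Module.End.mul_apply]; exact hR _ ih
    simp only [texp, LinearMap.sum_apply]
    exact S.sum_mem fun i _ => S.smul_mem _ (hp i)
  have hPpow : ∀ e ∈ S, ∀ r, N + 1 ≤ r → (P ^ r) e = 0 := fun e he r hr => by
    simpa using he (List.replicate r true) (by simp; omega)
  have hQpow : ∀ e ∈ S, ∀ r, N + 1 ≤ r → (Q ^ r) e = 0 := fun e he r hr => by
    simpa using he (List.replicate r false) (by simp; omega)
  -- on `S`, conjugation by `exp x exp y = 1 + n` is `exp (ad x) exp (ad y) = 1 + ν`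
  have hconj : ∀ e ∈ S, (1 + ν) e ∈ S ∧ (1 + ν) e * (1 + n) = (1 + n) * e := by
    intro e he
    have e1 : 1 + ν = texp (N + 1) P * texp (N + 1) Q := add_sub_cancel _ _
    have e2 : 1 + n = texp (N + 1) x * texp (N + 1) y := add_sub_cancel _ _
    rw [e1, e2, Module.End.mul_apply]
    refine ⟨hStexp P hSP _ (hStexp Q hSQ _ he), ?_⟩
    rw [← texp_mul_mul_texp_neg h.pow_left _ (hPpow _ (hStexp Q hSQ _ he)),
      ← texp_mul_mul_texp_neg h.pow_right _ (hQpow _ he)]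
    simp only [mul_assoc]
    rw [← mul_assoc (texp _ (-x)), texp_neg_mul_texp h.pow_left (by omega), one_mul,
      texp_neg_mul_texp h.pow_right (by omega), mul_one]
  -- the innermost letter `a` of a word acts on `θ` by `[a, θ] = -a`
  have hword : ∀ w : List Bool, w ≠ [] → (w.map fun b => bif b then P else Q).prod θ =
      -nestedBracket (w.map fun b => bif b then x else y) := by
    intro w hw
    rw [← prod_ad_apply_eq_neg_nestedBracket (θ := θ) (w.map fun b => bif b then x else y)
      (by simp only [List.mem_map]; rintro _ ⟨b, -, rfl⟩; cases b <;> assumption)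
      (by simpa using hw), List.map_map]
    congr 3
    ext b : 1
    cases b <;> rfl
  have hθ : θ ∈ S := fun w hw => by
    rw [hword w (by rintro rfl; simp at hw), h.nestedBracket_eq_zero hw, neg_zero]
  have hνpow : ∀ k, 1 ≤ k → (ν ^ k) θ =
      ∑ r : Fin k → Fin (N + 1), ∑ s : Fin k → Fin (N + 1),
        if ∀ i, 0 < (r i : ℕ) + s i then
          dynkinCoeff r s •
            -nestedBracket (dynkinWord (fun i => (r i : ℕ)) (fun i => (s i : ℕ)) x y)
        else 0 := by
    intro k hk
    simp only [ν, texp_mul_texp_sub_one_pow, LinearMap.sum_apply]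
    refine Finset.sum_congr rfl fun r _ => Finset.sum_congr rfl fun s _ => ?_
    split_ifs with hrs
    · rw [LinearMap.smul_apply, dynkinWord_eq_map, hword, ← dynkinWord_eq_map]
      rw [← List.length_pos_iff_ne_nil, dynkinWord_length]
      exact hk.trans (le_sum_of_pos hrs)
    · rfl
  have hνK : (ν ^ (N + 1)) θ = 0 := by
    rw [hνpow _ (by omega)]
    refine Finset.sum_eq_zero fun r _ => Finset.sum_eq_zero fun s _ => ?_
    split_ifs with hrs
    · rw [dynkinWord_eq_map, h.nestedBracket_eq_zero, neg_zero, smul_zero]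
      rw [dynkinWord_length]
      exact Nat.lt_of_succ_le (le_sum_of_pos hrs)
    · rfl
  have hlog := lie_unipLog_of_conj h.pow_eq_zero ν hνK (fun k => by
    suffices H : ((1 + ν) ^ k) θ ∈ S ∧ ((1 + ν) ^ k) θ * (1 + n) ^ k = (1 + n) ^ k * θ from H.2
    induction k with
    | zero => simpa using hθ
    | succ k ih =>
      obtain ⟨h1, h2⟩ := hconj _ ih.1
      rw [pow_succ' (1 + ν), Module.End.mul_apply]
      refine ⟨h1, ?_⟩
      rw [pow_succ' (1 + n), ← mul_assoc, h2, mul_assoc, ih.2, mul_assoc])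
  rw [← hn] at hlog
  -- `ad θ` multiplies each bracket by its length, which cancels the denominator in Dynkin's series
  have hD : ⁅θ, dynkinSeries N x y⁆ = -unipLog (N + 1) ν θ := by
    have : unipLog (N + 1) ν θ =
        ∑ k ∈ Finset.Icc 1 N, ((-1 : ℝ) ^ (k - 1) / k) • (ν ^ k) θ := by
      simp only [unipLog, LinearMap.sum_apply, LinearMap.smul_apply]
      refine (Finset.sum_subset_zero_on_sdiff (fun k hk => ?_) (fun k hk => ?_)
        (fun k hk => ?_)).symm
      · rw [Finset.mem_range]
        have := Finset.mem_Icc.1 hk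
        omega
      · have : k = 0 := by
          simp only [Finset.mem_sdiff, Finset.mem_range, Finset.mem_Icc] at hk
          omega
        simp [this]
      · rw [if_neg (by have := Finset.mem_Icc.1 hk; omega)]
    rw [this, dynkinSeries, lie_sum, ← Finset.sum_neg_distrib]
    refine Finset.sum_congr rfl fun k hk => ?_
    have hk1 := (Finset.mem_Icc.1 hk).1
    simp only [hνpow k hk1, lie_sum, Finset.smul_sum, ← Finset.sum_neg_distrib]
    refine Finset.sum_congr rfl fun r _ => Finset.sum_congr rfl fun s _ => ?_
    split_ifs with hrs
    · have hm : ((∑ i, ((r i : ℕ) + s i) : ℕ) : ℝ) ≠ 0 := by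
        have := hk1.trans (le_sum_of_pos hrs)
        positivity
      rw [lie_smul, lie_nestedBracket_eq_length_smul _ (hletters _ _), dynkinWord_length,
        smul_neg, smul_neg, neg_neg, smul_smul, smul_smul]
      congr 1
      field_simp
    · simp
  -- the span of the eigenspaces of `ad θ` with nonzero eigenvalue, where `ad θ` is injective
  let W : Submodule ℝ A := ⨆ μ : ℝ, ⨆ _ : μ ≠ 0,
    Module.End.eigenspace (LieAlgebra.ad ℝ A θ : Module.End ℝ A) μ
  have hW : ∀ (m : ℕ) (a : A), 1 ≤ m → ⁅θ, a⁆ = (m : ℝ) • a → a ∈ W := by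
    intro m a hm ha
    refine Submodule.mem_iSup_of_mem (m : ℝ) (Submodule.mem_iSup_of_mem ?_ ?_)
    · exact_mod_cast (show m ≠ 0 by omega)
    · exact Module.End.mem_eigenspace_iff.2 ha
  have hWlog : unipLog (N + 1) n ∈ W := by
    refine W.sum_mem fun k _ => ?_
    rcases Nat.eq_zero_or_pos k with rfl | hk
    · simp
    refine W.smul_mem _ ?_
    rw [hn, texp_mul_texp_sub_one_pow]
    refine W.sum_mem fun r _ => W.sum_mem fun s _ => ?_
    split_ifs with hrs
    · refine W.smul_mem _ (hW _ _ ?_ (lie_prod_eq_length_smul _ (hletters _ _)))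
      rw [dynkinWord_length]
      exact hk.trans_le (le_sum_of_pos hrs)
    · exact W.zero_mem
  have hWD : dynkinSeries N x y ∈ W := by
    refine W.sum_mem fun k hk => W.sum_mem fun r _ => W.sum_mem fun s _ => ?_
    split_ifs with hrs
    · refine W.smul_mem _ (hW _ _ ?_ (lie_nestedBracket_eq_length_smul _ (hletters _ _)))
      rw [dynkinWord_length]
      exact (Finset.mem_Icc.1 hk).1.trans (le_sum_of_pos hrs)
    · exact W.zero_mem
  have hzero : unipLog (N + 1) n - dynkinSeries N x y ∈
      Module.End.eigenspace (LieAlgebra.ad ℝ A θ : Module.End ℝ A) 0 := by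
    rw [Module.End.mem_eigenspace_iff, zero_smul, LieAlgebra.ad_apply, lie_sub, hD, ← hlog,
      LieRing.of_associative_ring_bracket]
    abel
  have hdisj := Module.End.eigenspaces_iSupIndep (LieAlgebra.ad ℝ A θ : Module.End ℝ A) 0
  exact sub_eq_zero.1 (Submodule.disjoint_def.1 hdisj _ hzero (W.sub_mem hWlog hWD))

theorem map_dynkinSeries_of_algHom {B F : Type*} [Ring B] [Algebra ℝ B] [FunLike F A B]
    [AlgHomClass F ℝ A B] (f : F) (N : ℕ) (x y : A) :
    f (dynkinSeries N x y) = dynkinSeries N (f x) (f y) :=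
  map_dynkinSeries f (fun a b => by
    simp only [LieRing.of_associative_ring_bracket, map_sub, map_mul]) N x y

open Polynomial in
/-- Evaluation at `1` of polynomials over a noncommutative algebra. -/
def evalOne (A : Type*) [Ring A] [Algebra ℝ A] : A[X] →ₐ[ℝ] A :=
  { eval₂RingHom' (RingHom.id A) 1 (fun a => Commute.one_right a) with
    commutes' := fun r => by
      change eval₂ (RingHom.id A) 1 (algebraMap ℝ A[X] r) = _
      rw [Polynomial.algebraMap_apply, eval₂_C]
      rfl }

open Polynomial in
/-- Dynkin's formula. The words in `x`, `y` are given a grading by passing to `λ x`, `λ y` over the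
polynomials in `λ`, where `λ d/dλ` counts the letters. -/
theorem unipLog_eq_dynkinSeries {N : ℕ} {x y : A} (h : WordsVanish N x y) :
    unipLog (N + 1) (texp (N + 1) x * texp (N + 1) y - 1) = dynkinSeries N x y := by
  let l : A[X] →ₐ[ℝ] Module.End ℝ A[X] := Algebra.lmul ℝ A[X]
  let θ : Module.End ℝ A[X] :=
    LinearMap.mulLeft ℝ (X : A[X]) ∘ₗ (derivative (R := A)).restrictScalars ℝ
  have hθ : ∀ a : A, θ * l (C a * X) - l (C a * X) * θ = l (C a * X) := by
    intro a
    ext1 p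
    change X * derivative ((C a * X) * p) - (C a * X) * (X * derivative p) = (C a * X) * p
    simp only [derivative_mul, derivative_C, derivative_X, zero_mul, zero_add, mul_one]
    rw [mul_add, ← mul_assoc X (C a) p, X_mul_C, ← mul_assoc X (C a * X), ← mul_assoc X (C a),
      X_mul_C]
    noncomm_ring
  have hw : WordsVanish N (C x * X : A[X]) (C y * X) := by
    intro w hw
    have : ∀ w : List Bool, (w.map fun b => bif b then (C x * X : A[X]) else C y * X).prod =
        C (w.map fun b => bif b then x else y).prod * X ^ w.length := by
      intro w
      induction w with
      | nil => simp
      | cons b w ih =>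
        rw [List.map_cons, List.prod_cons, ih, List.map_cons, List.prod_cons, C_mul,
          List.length_cons, pow_succ']
        cases b <;> simp only [cond_true, cond_false, mul_assoc] <;>
          rw [← mul_assoc X (C _), X_mul_C, mul_assoc]
    rw [this, h w hw, C_0, zero_mul]
  have hlw : WordsVanish N (l (C x * X)) (l (C y * X)) := by
    intro w hN
    have := congrArg l (hw w hN)
    rw [map_list_prod, List.map_map, map_zero] at this
    rw [← this]
    congr 2
    ext1 b
    cases b <;> rfl
  have key := unipLog_eq_dynkinSeries_of_grading hlw (hθ x) (hθ y)
  rw [← map_texp l, ← map_texp l, ← map_mul, ← map_one l, ← map_sub, ← map_unipLog l,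
    ← map_dynkinSeries_of_algHom l] at key
  have key2 := congrArg (evalOne A) (Algebra.lmul_injective key)
  have hev : ∀ a : A, evalOne A (C a * X) = a := fun a => by
    change eval₂ (RingHom.id A) 1 (C a * X) = a
    rw [eval₂_mul_X, eval₂_C, mul_one]
    rfl
  simpa only [map_unipLog, map_sub, map_mul, map_texp, map_one, map_dynkinSeries_of_algHom,
    hev] using key2

theorem texp_dynkinSeries {N : ℕ} {x y : A} (h : WordsVanish N x y) :
    texp (N + 1) (dynkinSeries N x y) = texp (N + 1) x * texp (N + 1) y := by
  rw [← unipLog_eq_dynkinSeries h, texp_unipLog h.pow_eq_zero, add_sub_cancel]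

end Associative

/-! ### Conjugation in the osculating group -/

section TexpConj

variable {A : Type*} [Ring A] [Algebra ℝ A]

theorem texp_conj {a b : A} (hba : b * a = 1) (hab : a * b = 1) (K : ℕ) (z : A) :
    a * texp K z * b = texp K (a * z * b) := by
  have h : ∀ i, a * z ^ i * b = (a * z * b) ^ i := by
    intro i
    induction i with
    | zero => simp [hab]
    | succ i ih =>
      rw [pow_succ, pow_succ, ← ih]
      calc a * (z ^ i * z) * b = a * z ^ i * 1 * z * b := by noncomm_ring
        _ = _ := by rw [← hba]; noncomm_ring
  simp only [texp, Finset.mul_sum, Finset.sum_mul, mul_smul_comm, smul_mul_assoc, h]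

theorem texp_injective {a b : A} {K : ℕ} (ha : a ^ K = 0) (hb : b ^ K = 0)
    (h : texp K a = texp K b) : a = b := by
  have ha' := pow_eq_zero_of_le (show K ≤ K + 2 by omega) ha
  have hb' := pow_eq_zero_of_le (show K ≤ K + 2 by omega) hb
  rw [← unipLog_texp_sub_one ha' (by omega), ← unipLog_texp_sub_one hb' (by omega),
    texp_eq_of_le ha (by omega), texp_eq_of_le hb (by omega), h]

end TexpConj

variable {E : Type*} [NormedAddCommGroup E] [NormedSpace ℝ E] [FiniteDimensional ℝ E]
  {M : Type*} [TopologicalSpace M] [ChartedSpace E M] [IsManifold 𝓘(ℝ, E) ∞ M]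
  {N : ℕ} {F : WeightedSubRiem E M N} {x : M}

namespace WeightedSubRiem

theorem lie_cls {i j : ℕ} (hi : 1 ≤ i) (hj : 1 ≤ j) (X : F.modR i) (Y : F.modR j) :
    ⁅F.cls x i X, F.cls x j Y⁆ = F.cls x (i + j) (F.modBracket i j X Y) :=
  oscBracket_cls hi hj X Y

variable (F x) in
/-- The subspace of the osculating Lie algebra spanned by the classes of degree larger than `m`. -/
def fil (m : ℕ) : Submodule ℝ (F.Osc x) :=
  Submodule.span ℝ {u | ∃ k, m < k ∧ ∃ X : F.modR k, u = F.cls x k X}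

theorem fil_zero : F.fil x 0 = ⊤ := by
  refine eq_top_iff.2 fun u _ => ?_
  obtain ⟨X, rfl⟩ := exists_eq_sum_cls u
  exact Submodule.sum_mem _ fun k _ => Submodule.subset_span ⟨k, k.2.1, X k, rfl⟩

theorem fil_eq_bot {m : ℕ} (hm : N ≤ m) : F.fil x m = ⊥ := by
  refine Submodule.span_eq_bot.2 ?_
  rintro _ ⟨k, hk, X, rfl⟩
  exact cls_of_notMem (fun h => by have := h.2; omega) X

theorem lie_mem_fil {m : ℕ} (u : F.Osc x) {v : F.Osc x} (hv : v ∈ F.fil x m) :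
    ⁅u, v⁆ ∈ F.fil x (m + 1) := by
  induction hv using Submodule.span_induction with
  | mem v hv =>
    obtain ⟨k, hk, Y, rfl⟩ := hv
    induction u using osc_induction with
    | h0 => rw [zero_lie]; exact zero_mem _
    | hadd u u' h h' => rw [add_lie]; exact add_mem h h'
    | hcls i hi X =>
      rw [lie_cls hi (by omega)]
      exact Submodule.subset_span ⟨i + k, by omega, _, rfl⟩
  | zero => rw [lie_zero]; exact zero_mem _
  | add v w _ _ h h' => rw [lie_add]; exact add_mem h h'
  | smul c v _ h => rw [lie_smul]; exact Submodule.smul_mem _ _ h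

theorem ad_pow_eq_zero (g : F.Osc x) :
    (LieAlgebra.ad ℝ (F.Osc x) g : Module.End ℝ (F.Osc x)) ^ (N + 1) = 0 := by
  have h : ∀ m u, ((LieAlgebra.ad ℝ (F.Osc x) g : Module.End ℝ (F.Osc x)) ^ m) u ∈ F.fil x m := by
    intro m u
    induction m with
    | zero => rw [fil_zero]; trivial
    | succ m ih =>
      rw [pow_succ', Module.End.mul_apply]
      exact lie_mem_fil g ih
  ext u : 1
  have := h (N + 1) u
  rwa [fil_eq_bot (by omega), Submodule.mem_bot] at this

variable (F x) in
/-- The derivation of the osculating Lie algebra multiplying the degree `k` piece by `k`. -/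
def degDer : F.Osc x →ₗ[ℝ] F.Osc x where
  toFun u := fun k => ((k : ℕ) : ℝ) • F.proj x k u
  map_add' u v := funext fun k => by rw [map_add, smul_add]; rfl
  map_smul' c u := funext fun k => by rw [map_smul, smul_comm]; rfl

theorem proj_degDer (k : Set.Icc 1 N) (u : F.Osc x) :
    F.proj x k (F.degDer x u) = ((k : ℕ) : ℝ) • F.proj x k u := rfl

theorem degDer_injective : Function.Injective (F.degDer x) := by
  rw [injective_iff_map_eq_zero]
  intro u hu
  refine funext fun k => ?_
  have h := congrArg (F.proj x k) hu
  have hk : ((k : ℕ) : ℝ) ≠ 0 := by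
    have := k.2.1
    exact_mod_cast (show (k : ℕ) ≠ 0 by omega)
  rw [proj_degDer, map_zero] at h
  exact (inv_smul_smul₀ hk (F.proj x k u)).symm.trans (by rw [h, smul_zero]; rfl)

theorem degDer_cls (k : ℕ) (X : F.modR k) :
    F.degDer x (F.cls x k X) = (k : ℝ) • F.cls x k X := by
  by_cases hk : k ∈ Set.Icc 1 N
  swap
  · rw [cls_of_notMem hk, map_zero, smul_zero]
  lift k to Set.Icc 1 N using hk
  suffices h : ∀ l, F.proj x l (F.degDer x (F.cls x k X)) =
    F.proj x l (((k : ℕ) : ℝ) • F.cls x k X) from funext h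
  intro l
  rw [proj_degDer, map_smul]
  rcases eq_or_ne k l with rfl | hl
  · rfl
  · rw [proj_cls_of_ne hl, smul_zero, smul_zero]

theorem degDer_lie (u v : F.Osc x) :
    F.degDer x ⁅u, v⁆ = ⁅F.degDer x u, v⁆ + ⁅u, F.degDer x v⁆ := by
  induction u using osc_induction with
  | h0 => simp
  | hadd u u' h h' => simp only [add_lie, map_add, h, h']; abel
  | hcls i hi X =>
    induction v using osc_induction with
    | h0 => simp
    | hadd v v' h h' => simp only [lie_add, map_add, h, h']; abel
    | hcls j hj Y =>
      rw [lie_cls hi hj, degDer_cls, degDer_cls, degDer_cls, smul_lie, lie_smul, lie_cls hi hj,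
        Nat.cast_add, add_smul]

attribute [local instance] LieRing.ofAssociativeRing

variable (F x) in
/-- The adjoint action of the osculating Lie algebra on its semidirect product with the line
spanned by the derivation `degDer`. It is faithful and nilpotent. -/
def oscRep : F.Osc x →ₗ[ℝ] Module.End ℝ (F.Osc x × ℝ) :=
  LinearMap.mk₂ ℝ (fun u p => ((⁅u, p.1⁆ - p.2 • F.degDer x u, 0) : F.Osc x × ℝ))
    (fun u u' p => Prod.ext (by simp only [add_lie, map_add, smul_add, Prod.fst_add]; abel)
      (by simp))
    (fun c u p => Prod.ext (by
      simp only [smul_lie, map_smul, Prod.smul_fst, smul_sub, smul_comm c]) (by simp))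
    (fun u p q => Prod.ext (by
      simp only [lie_add, Prod.fst_add, Prod.snd_add, add_smul]; abel) (by simp))
    (fun c u p => Prod.ext (by
      simp only [lie_smul, Prod.smul_fst, Prod.smul_snd, smul_sub, smul_eq_mul, mul_smul])
      (by simp))

theorem oscRep_apply (u : F.Osc x) (p : F.Osc x × ℝ) :
    F.oscRep x u p = (⁅u, p.1⁆ - p.2 • F.degDer x u, 0) := rfl

theorem oscRep_lie (u v : F.Osc x) : F.oscRep x ⁅u, v⁆ = ⁅F.oscRep x u, F.oscRep x v⁆ := by
  refine LinearMap.ext fun p => ?_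
  rw [LieRing.of_associative_ring_bracket, LinearMap.sub_apply, Module.End.mul_apply,
    Module.End.mul_apply]
  simp only [oscRep_apply, degDer_lie, lie_sub, lie_smul, lie_lie, smul_add]
  refine Prod.ext ?_ (by simp)
  simp only [zero_smul, sub_zero, Prod.fst_sub]
  rw [← lie_skew v (F.degDer x u)]
  module

theorem oscRep_injective : Function.Injective (F.oscRep x) := by
  rw [injective_iff_map_eq_zero]
  intro u hu
  have h := congrArg Prod.fst (LinearMap.congr_fun hu (0, 1))
  simp only [oscRep_apply, lie_zero, one_smul, zero_sub, LinearMap.zero_apply, Prod.fst_zero,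
    neg_eq_zero] at h
  exact degDer_injective (h.trans (map_zero _).symm)

theorem oscRep_words_vanish (l : List (F.Osc x)) (hl : N < l.length) :
    (l.map (F.oscRep x)).prod = 0 := by
  have h : ∀ (l : List (F.Osc x)) (u : F.Osc x) (p : F.Osc x × ℝ),
      (((u :: l).map (F.oscRep x)).prod p).2 = 0 ∧
        (((u :: l).map (F.oscRep x)).prod p).1 ∈ F.fil x l.length := by
    intro l
    induction l with
    | nil =>
      intro u p
      exact ⟨rfl, by rw [List.length_nil, fil_zero]; trivial⟩
    | cons v l ih =>
      intro u p
      rw [List.map_cons, List.prod_cons, Module.End.mul_apply, oscRep_apply, (ih v p).1]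
      refine ⟨rfl, ?_⟩
      rw [zero_smul, sub_zero]
      exact lie_mem_fil u (ih v p).2
  match l, hl with
  | u :: l, hl =>
    refine LinearMap.ext fun p => Prod.ext ?_ (h l u p).1
    have := (h l u p).2
    rw [fil_eq_bot (by simp at hl; omega), Submodule.mem_bot] at this
    exact this

theorem oscRep_pow_eq_zero (u : F.Osc x) : F.oscRep x u ^ (N + 1) = 0 := by
  simpa using oscRep_words_vanish (List.replicate (N + 1) u) (by simp)

theorem oscRep_wordsVanish (u v : F.Osc x) : WordsVanish N (F.oscRep x u) (F.oscRep x v) := by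
  intro w hw
  rw [← oscRep_words_vanish (w.map fun b => bif b then u else v) (by simpa using hw), List.map_map]
  congr 2
  ext1 b
  cases b <;> rfl

/-- The osculating group acts linearly through `u ↦ exp (-oscRep u)`. -/
theorem texp_oscRep_oscMul (u v : F.Osc x) :
    texp (N + 1) (F.oscRep x (-oscMul u v)) =
      texp (N + 1) (F.oscRep x (-u)) * texp (N + 1) (F.oscRep x (-v)) := by
  rw [oscMul, bchMul_eq, neg_neg, map_dynkinSeries (F.oscRep x) oscRep_lie,
    texp_dynkinSeries (oscRep_wordsVanish _ _)]

/-- The adjoint action of the osculating group on its Lie algebra. The sign comes from the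
convention that the Lie algebra consists of right-invariant vector fields. -/
def oscAd (g : F.Osc x) : Module.End ℝ (F.Osc x) :=
  texp (N + 1) (-(LieAlgebra.ad ℝ (F.Osc x) g : Module.End ℝ (F.Osc x)))

theorem oscRep_oscAd (g v : F.Osc x) :
    F.oscRep x (oscAd g v) = texp (N + 1) (F.oscRep x (-g)) * F.oscRep x v *
      texp (N + 1) (F.oscRep x g) := by
  have hr : ∀ r, ((LieAlgebra.ad ℝ (Module.End ℝ (F.Osc x × ℝ)) (F.oscRep x (-g)) :
      Module.End ℝ (Module.End ℝ (F.Osc x × ℝ))) ^ r) (F.oscRep x v) =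
      F.oscRep x (((-(LieAlgebra.ad ℝ (F.Osc x) g : Module.End ℝ (F.Osc x))) ^ r) v) := by
    intro r
    induction r with
    | zero => rfl
    | succ r ih =>
      rw [pow_succ', Module.End.mul_apply, ih, pow_succ', Module.End.mul_apply,
        LieAlgebra.ad_apply, ← oscRep_lie, LinearMap.neg_apply, LieAlgebra.ad_apply, neg_lie]
  have h := texp_mul_mul_texp_neg (oscRep_pow_eq_zero (-g)) (F.oscRep x v) (fun r hr' => by
    rw [hr, pow_eq_zero_of_le hr' (neg_pow_eq_zero (ad_pow_eq_zero g)), LinearMap.zero_apply,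
      map_zero])
  rw [← map_neg, neg_neg] at h
  rw [h]
  simp only [oscAd, texp, LinearMap.sum_apply, LinearMap.smul_apply, map_sum, map_smul, hr]

/-- Conjugation in the osculating group is the linear adjoint action. -/
theorem oscConj_eq_oscAd (g v : F.Osc x) : oscConj g v = oscAd g v := by
  have h1 : texp (N + 1) (F.oscRep x (-oscConj g v)) =
      texp (N + 1) (F.oscRep x (-oscAd g v)) := by
    rw [oscConj, texp_oscRep_oscMul, texp_oscRep_oscMul, neg_neg, ← map_neg (oscAd g) v,
      oscRep_oscAd]
    have hg := oscRep_pow_eq_zero g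
    refine texp_conj ?_ ?_ _ _ <;> rw [map_neg]
    · exact texp_mul_texp_neg hg (by omega)
    · exact texp_neg_mul_texp hg (by omega)
  have h2 := oscRep_injective
    (texp_injective (oscRep_pow_eq_zero _) (oscRep_pow_eq_zero _) h1)
  exact neg_injective h2

theorem oscAd_natCast_smul (g : F.Osc x) (m : ℕ) : oscAd ((m : ℝ) • g) = oscAd g ^ m := by
  rw [oscAd, map_smul, ← smul_neg]
  exact texp_natCast_smul (neg_pow_eq_zero (ad_pow_eq_zero g)) (by omega) m

theorem oscAd_bijective (g : F.Osc x) : Function.Bijective (oscAd g) := by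
  have h := ad_pow_eq_zero g
  let T : Module.End ℝ (F.Osc x) := texp (N + 1) (LieAlgebra.ad ℝ (F.Osc x) g)
  exact Function.bijective_iff_has_inverse.2
    ⟨T,
      LinearMap.congr_fun (texp_mul_texp_neg h (by omega)),
      LinearMap.congr_fun (texp_neg_mul_texp h (by omega))⟩

end WeightedSubRiem

/-! ### The topology of the Grassmannian -/

section GrassTopology

variable {V : Type*} [NormedAddCommGroup V] [NormedSpace ℝ V] [FiniteDimensional ℝ V] {d : ℕ}

theorem isModuleTopology_of_finiteDimensional (W : Type*) [NormedAddCommGroup W] [NormedSpace ℝ W]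
    [FiniteDimensional ℝ W] : IsModuleTopology ℝ W :=
  IsModuleTopology.iso
    (ContinuousLinearEquiv.ofFinrankEq (E := Fin (Module.finrank ℝ W) → ℝ) (F := W) (by simp))

/-- The continuous linear maps and the linear maps between finite-dimensional spaces have the same
topology. -/
theorem continuous_toContinuousLinearMap_moduleTopology :
    (@Continuous (V →L[ℝ] (Fin d → ℝ)) (V →ₗ[ℝ] (Fin d → ℝ)) _ (moduleTopology ℝ _)
      fun f => (f : V →ₗ[ℝ] (Fin d → ℝ))) ∧
    (@Continuous (V →ₗ[ℝ] (Fin d → ℝ)) (V →L[ℝ] (Fin d → ℝ)) (moduleTopology ℝ _) _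
      fun f => LinearMap.toContinuousLinearMap f) := by
  let _ : TopologicalSpace (V →ₗ[ℝ] (Fin d → ℝ)) := moduleTopology ℝ _
  have : IsModuleTopology ℝ (V →ₗ[ℝ] (Fin d → ℝ)) := ⟨rfl⟩
  have : ContinuousAdd (V →ₗ[ℝ] (Fin d → ℝ)) := IsModuleTopology.toContinuousAdd ℝ _
  have : IsModuleTopology ℝ (V →L[ℝ] (Fin d → ℝ)) := isModuleTopology_of_finiteDimensional _
  constructor
  · exact IsModuleTopology.continuous_of_linearMap
      (LinearMap.toContinuousLinearMap (𝕜 := ℝ) (E := V) (F' := Fin d → ℝ)).symm.toLinearMap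
  · exact IsModuleTopology.continuous_of_linearMap
      (LinearMap.toContinuousLinearMap (𝕜 := ℝ) (E := V) (F' := Fin d → ℝ)).toLinearMap

/-- The topology of the Grassmannian in terms of the normed space of continuous linear maps. -/
theorem isOpen_grass_iff (O : Set (Grass V d)) : IsOpen O ↔
    ∃ P : Set (V →L[ℝ] (Fin d → ℝ)), IsOpen P ∧
      ∀ (f : V →L[ℝ] (Fin d → ℝ)) (hf : Function.Surjective (f : V →ₗ[ℝ] (Fin d → ℝ))),
        f ∈ P ↔ kerGrass (by simp) (f : V →ₗ[ℝ] (Fin d → ℝ)) hf ∈ O := by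
  let _ : TopologicalSpace (V →ₗ[ℝ] (Fin d → ℝ)) := moduleTopology ℝ _
  obtain ⟨h1, h2⟩ := continuous_toContinuousLinearMap_moduleTopology (V := V) (d := d)
  rw [isOpen_coinduced, isOpen_induced_iff]
  constructor
  · rintro ⟨P, hP, hPO⟩
    refine ⟨_, hP.preimage h1, fun f hf => ?_⟩
    exact Set.ext_iff.1 hPO ⟨(f : V →ₗ[ℝ] (Fin d → ℝ)), hf⟩
  · rintro ⟨P, hP, hPO⟩
    refine ⟨_, hP.preimage h2, ?_⟩
    ext ⟨f, hf⟩
    exact hPO (LinearMap.toContinuousLinearMap f) hf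

/-- The kernel depends continuously on the surjective linear map. -/
theorem eventually_kerGrass_mem {O : Set (Grass V d)} (hO : IsOpen O) {f₀ : V →L[ℝ] (Fin d → ℝ)}
    (hf₀ : Function.Surjective (f₀ : V →ₗ[ℝ] (Fin d → ℝ)))
    (h : kerGrass (by simp) (f₀ : V →ₗ[ℝ] (Fin d → ℝ)) hf₀ ∈ O) :
    ∀ᶠ f : V →L[ℝ] (Fin d → ℝ) in 𝓝 f₀, ∀ hf : Function.Surjective (f : V →ₗ[ℝ] (Fin d → ℝ)),
      kerGrass (by simp) (f : V →ₗ[ℝ] (Fin d → ℝ)) hf ∈ O := by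
  obtain ⟨P, hP, hPO⟩ := (isOpen_grass_iff O).1 hO
  filter_upwards [hP.mem_nhds ((hPO f₀ hf₀).2 h)] with f hf hs
  exact (hPO f hs).1 hf

/-- The kernel map is open: two surjective maps with the same kernel differ by an automorphism of
the target. -/
theorem isOpen_setOf_exists_ker {P : Set (V →L[ℝ] (Fin d → ℝ))} (hP : IsOpen P) :
    IsOpen {K : Grass V d | ∃ f ∈ P, Function.Surjective (f : V →ₗ[ℝ] (Fin d → ℝ)) ∧
      LinearMap.ker (f : V →ₗ[ℝ] (Fin d → ℝ)) = K.1} := by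
  rw [isOpen_grass_iff]
  refine ⟨⋃ e : (Fin d → ℝ) ≃L[ℝ] (Fin d → ℝ),
    (fun f => (e : (Fin d → ℝ) →L[ℝ] (Fin d → ℝ)).comp f) ⁻¹' P,
    isOpen_iUnion fun e => hP.preimage (continuous_const.clm_comp continuous_id), fun f hf => ?_⟩
  constructor
  · intro h
    obtain ⟨e, he⟩ := Set.mem_iUnion.1 h
    refine ⟨_, he, e.surjective.comp hf, ?_⟩
    ext v
    simp [kerGrass]
  · rintro ⟨f', hf'P, hf', hk⟩
    have hk : LinearMap.ker (f' : V →ₗ[ℝ] (Fin d → ℝ)) =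
      LinearMap.ker (f : V →ₗ[ℝ] (Fin d → ℝ)) := hk
    let e : (Fin d → ℝ) ≃ₗ[ℝ] (Fin d → ℝ) :=
      ((f : V →ₗ[ℝ] (Fin d → ℝ)).quotKerEquivOfSurjective hf).symm.trans
        ((Submodule.quotEquivOfEq _ _ hk.symm).trans
          ((f' : V →ₗ[ℝ] (Fin d → ℝ)).quotKerEquivOfSurjective hf'))
    have he : (e.toContinuousLinearEquiv : (Fin d → ℝ) →L[ℝ] (Fin d → ℝ)).comp f = f' := by
      refine ContinuousLinearMap.ext fun v => ?_
      have : ((f : V →ₗ[ℝ] (Fin d → ℝ)).quotKerEquivOfSurjective hf).symm (f v) =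
          Submodule.Quotient.mk v := by
        rw [LinearEquiv.symm_apply_eq]
        rfl
      exact congrArg (fun z => (f' : V →ₗ[ℝ] (Fin d → ℝ)).quotKerEquivOfSurjective hf'
        (Submodule.quotEquivOfEq _ _ hk.symm z)) this
    refine Set.mem_iUnion.2 ⟨e.toContinuousLinearEquiv, ?_⟩
    rwa [Set.mem_preimage, he]

theorem exists_surjective_ker_eq (K : Grass V d) : ∃ f : V →L[ℝ] (Fin d → ℝ),
    Function.Surjective (f : V →ₗ[ℝ] (Fin d → ℝ)) ∧
      LinearMap.ker (f : V →ₗ[ℝ] (Fin d → ℝ)) = K.1 := by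
  let e : (V ⧸ K.1) ≃ₗ[ℝ] (Fin d → ℝ) := LinearEquiv.ofFinrankEq _ _ (by rw [K.2]; simp)
  refine ⟨LinearMap.toContinuousLinearMap (e.toLinearMap ∘ₗ K.1.mkQ),
    e.surjective.comp K.1.mkQ_surjective, ?_⟩
  ext v
  simp

theorem surjective_of_finrank_quotient_ker {V : Type*} [AddCommGroup V] [Module ℝ V] {d : ℕ}
    (f : V →ₗ[ℝ] (Fin d → ℝ)) (hf : Module.finrank ℝ (V ⧸ LinearMap.ker f) = d) :
    Function.Surjective f := by
  rw [← LinearMap.range_eq_top]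
  refine Submodule.eq_top_of_finrank_eq ?_
  rw [← f.quotKerEquivRange.finrank_eq, hf]
  simp

end GrassTopology

/-! ### Limit subspaces in terms of defining linear maps -/

section LimitSubspaces

variable {E : Type*} [NormedAddCommGroup E] [NormedSpace ℝ E] [FiniteDimensional ℝ E]
  {M : Type*} [TopologicalSpace M] [ChartedSpace E M] [IsManifold 𝓘(ℝ, E) ∞ M] [T2Space M]
  {N : ℕ} {F : WeightedSubRiem E M N}
  {V : Set.Icc 1 N → Type*} [∀ i, NormedAddCommGroup (V i)] [∀ i, NormedSpace ℝ (V i)]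
  [∀ i, FiniteDimensional ℝ (V i)] (B : GradedBasis F V)

/-- The triples `(f, y, t)` such that `t > 0` and `f : V → ℝᵈ` defines the subspace
`ker ♮_{y,t}`. -/
def GradedBasis.kerGraph : Set (((∀ i, V i) →L[ℝ] (Fin (Module.finrank ℝ E) → ℝ)) × M × ℝ) :=
  {p | 0 < p.2.2 ∧ LinearMap.ker (p.1 : (∀ i, V i) →ₗ[ℝ] (Fin (Module.finrank ℝ E) → ℝ)) =
    LinearMap.ker (B.natAt p.2.1 p.2.2)}

/-- Since the kernel map is continuous and open, limits of subspaces can be computed with linear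
maps that define the subspaces, and the Grassmannian disappears from the description of the limit
subspaces. -/
theorem GradedBasis.mem_limitSubspaces_iff {x : M} (L : F.GrassAt x) :
    L ∈ B.limitSubspaces x ↔ ∃ f₀ : (∀ i, V i) →L[ℝ] (Fin (Module.finrank ℝ E) → ℝ),
      Function.Surjective (f₀ : (∀ i, V i) →ₗ[ℝ] (Fin (Module.finrank ℝ E) → ℝ)) ∧
      LinearMap.ker (f₀ : (∀ i, V i) →ₗ[ℝ] (Fin (Module.finrank ℝ E) → ℝ)) =
        L.1.comap (B.natZero x) ∧
      (f₀, x, (0 : ℝ)) ∈ closure B.kerGraph := by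
  have hL : L ∈ B.limitSubspaces x ↔
      B.grassNat (Sum.inr ⟨x, L⟩) ∈ closure (B.grassNat '' Set.range Sum.inl) :=
    closure_induced
  rw [hL]
  constructor
  · intro h
    obtain ⟨f₀, hf₀, hk⟩ := exists_surjective_ker_eq
      (comapGrass (B.natZero x) (B.natZero_surjective x) L)
    refine ⟨f₀, hf₀, hk, ?_⟩
    rw [mem_closure_iff_nhds]
    intro U hU
    rw [nhds_prod_eq, nhds_prod_eq, Filter.mem_prod_iff] at hU
    obtain ⟨P, hP, U', hU', hPU⟩ := hU
    obtain ⟨Q, hQ, I, hI, hQI⟩ := Filter.mem_prod_iff.1 hU'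
    obtain ⟨P', hPP', hP'o, hfP'⟩ := mem_nhds_iff.1 hP
    have hO := (isOpen_setOf_exists_ker hP'o).mem_nhds
      (show comapGrass (B.natZero x) (B.natZero_surjective x) L ∈ _ from ⟨f₀, hfP', hf₀, hk⟩)
    have hI' : (fun s : NNReal => (s : ℝ)) ⁻¹' I ∈ 𝓝 (0 : NNReal) :=
      NNReal.continuous_coe.continuousAt.preimage_mem_nhds (by simpa using hI)
    obtain ⟨_, ⟨⟨f, hfP, hfs, hfk⟩, hyQ, htI⟩, _, ⟨⟨y, t⟩, rfl⟩, rfl⟩ :=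
      mem_closure_iff_nhds.1 h _ (prod_mem_nhds hO (prod_mem_nhds hQ hI'))
    exact ⟨(f, y, t), hPU ⟨hPP' hfP, hQI ⟨hyQ, htI⟩⟩, t.2, hfk⟩
  · rintro ⟨f₀, hf₀, hk, h⟩
    rw [mem_closure_iff_nhds]
    intro U hU
    have hU : U ∈ 𝓝 ((comapGrass (B.natZero x) (B.natZero_surjective x) L, x, (0 : NNReal)) :
      Grass (∀ i, V i) (Module.finrank ℝ E) × M × NNReal) := hU
    rw [nhds_prod_eq, nhds_prod_eq, Filter.mem_prod_iff] at hU
    obtain ⟨O, hO, U', hU', hOU⟩ := hU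
    obtain ⟨Q, hQ, I, hI, hQI⟩ := Filter.mem_prod_iff.1 hU'
    obtain ⟨O', hOO', hO'o, hLO'⟩ := mem_nhds_iff.1 hO
    have hk' : kerGrass (by simp) (f₀ : (∀ i, V i) →ₗ[ℝ] (Fin (Module.finrank ℝ E) → ℝ)) hf₀ =
      comapGrass (B.natZero x) (B.natZero_surjective x) L := Subtype.ext hk
    have hP := eventually_kerGrass_mem hO'o hf₀ (by rwa [hk'])
    have hI' : Real.toNNReal ⁻¹' I ∈ 𝓝 (0 : ℝ) :=
      continuous_real_toNNReal.continuousAt.preimage_mem_nhds (by simpa using hI)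
    obtain ⟨⟨f, y, t⟩, ⟨hfP, hyQ, htI⟩, ht, hfk⟩ :=
      mem_closure_iff_nhds.1 h _ (prod_mem_nhds hP (prod_mem_nhds hQ hI'))
    refine ⟨_, hOU (Set.mk_mem_prod (hOO' ?_) (hQI (Set.mk_mem_prod hyQ ?_))), _,
      ⟨(y, ⟨t, ht⟩), rfl⟩, rfl⟩
    · have hfs : Function.Surjective
          (f : (∀ i, V i) →ₗ[ℝ] (Fin (Module.finrank ℝ E) → ℝ)) := by
        refine surjective_of_finrank_quotient_ker _ ?_
        rw [hfk]
        exact (kerGrass (W := TangentSpace 𝓘(ℝ, E) y) rfl (B.natAt y t)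
          (B.natAt_surjective y ht)).2
      have := hfP hfs
      convert! this using 1
      exact Subtype.ext hfk.symm
    · have : (⟨t, ht.le⟩ : NNReal) = t.toNNReal := (Real.toNNReal_of_nonneg ht.le).symm
      rw [this]
      exact htI

end LimitSubspaces

/-! ### Lifting the Lie bracket to a graded basis -/

section Lift

variable {E : Type*} [NormedAddCommGroup E] [NormedSpace ℝ E] [FiniteDimensional ℝ E]
  {M : Type*} [TopologicalSpace M] [ChartedSpace E M] [IsManifold 𝓘(ℝ, E) ∞ M]
  {N : ℕ} {F : WeightedSubRiem E M N}
  {V : Set.Icc 1 N → Type*} [∀ i, AddCommGroup (V i)] [∀ i, Module ℝ (V i)]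
  [∀ i, FiniteDimensional ℝ (V i)] (B : GradedBasis F V)

namespace GradedBasis

variable (V) in
/-- The index set of a homogeneous basis of `V`. -/
abbrev BasisIndex : Type := Σ i : Set.Icc 1 N, Fin (Module.finrank ℝ (V i))

variable (V) in
/-- A homogeneous basis of `V`. -/
def homBasis : Module.Basis (BasisIndex V) ℝ (∀ i, V i) :=
  Pi.basis fun i => Module.finBasis ℝ (V i)

theorem homBasis_apply (p : BasisIndex V) [DecidableEq (Set.Icc 1 N)] :
    homBasis V p = Pi.single p.1 (Module.finBasis ℝ (V p.1) p.2) := by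
  rw [homBasis, Pi.basis_apply]

/-- The vector fields given by the homogeneous basis. -/
def natBasis (p : BasisIndex V) : VField E M := B.nat p.1 (Module.finBasis ℝ (V p.1) p.2)

theorem natBasis_mem (p : BasisIndex V) : B.natBasis p ∈ F.mod p.1 := B.nat_mem _ _

theorem natT_homBasis (t : ℝ) (p : BasisIndex V) :
    B.natT t (homBasis V p) = t ^ (p.1 : ℕ) • B.natBasis p := by
  classical
  rw [homBasis_apply, natT, LinearMap.sum_apply, Finset.sum_eq_single p.1]
  · simp [natBasis]
  · intro i _ hi
    simp [Pi.single_eq_of_ne hi]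
  · simp

theorem natZero_homBasis (x : M) (p : BasisIndex V) :
    B.natZero x (homBasis V p) = F.cls x p.1 ⟨B.natBasis p, B.natBasis_mem p⟩ := by
  classical
  rw [homBasis_apply, natZero_single]
  rfl

/-- A vector field in `F^k` is a combination of the basis fields of degree at most `k`. -/
theorem exists_coeff {k : ℕ} (hk : k ∈ Set.Icc 1 N) {Y : VField E M} (hY : Y ∈ F.mod k) :
    ∃ c : BasisIndex V → SmoothFun E M, (∀ p, k < p.1 → c p = 0) ∧
      Y = ∑ p, c p • B.natBasis p := by
  rw [show F.mod k = _ from (B.span_eq ⟨k, hk⟩).symm] at hY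
  induction hY using Submodule.span_induction with
  | mem Y hY =>
    obtain ⟨v, hv, rfl⟩ := hY
    refine ⟨fun p => algebraMap ℝ (SmoothFun E M) ((Module.finBasis ℝ (V p.1)).repr (v p.1) p.2),
      fun p hp => by simp [hv p.1 hp], ?_⟩
    rw [Fintype.sum_sigma]
    refine Finset.sum_congr rfl fun i _ => ?_
    conv_lhs => rw [← (Module.finBasis ℝ (V i)).sum_repr (v i), map_sum]
    refine Finset.sum_congr rfl fun a _ => ?_
    rw [map_smul, algebraMap_smul]
    rfl
  | zero => exact ⟨0, fun _ _ => rfl, by simp⟩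
  | add Y Z _ _ hY hZ =>
    obtain ⟨c, hc, rfl⟩ := hY
    obtain ⟨c', hc', rfl⟩ := hZ
    exact ⟨c + c', fun p hp => by simp [hc p hp, hc' p hp],
      by simp [add_smul, Finset.sum_add_distrib]⟩
  | smul f Y _ hY =>
    obtain ⟨c, hc, rfl⟩ := hY
    exact ⟨f • c, fun p hp => by simp [hc p hp], by simp [mul_smul, Finset.smul_sum]⟩

/-- In the class of degree `k` of a combination of basis fields only the fields of degree `k`
contribute, and their coefficients may be frozen at `x`. -/
theorem cls_eq_of_coeff (x : M) {k : ℕ} (Y : F.modR k)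
    {c : BasisIndex V → SmoothFun E M} (hc : ∀ p, k < p.1 → c p = 0)
    (hY : Y.1 = ∑ p, c p • B.natBasis p) :
    F.cls x k Y = ∑ p : BasisIndex V, if (p.1 : ℕ) = k then
      c p x • F.cls x p.1 ⟨B.natBasis p, B.natBasis_mem p⟩ else 0 := by
  let Z : F.modR k := ∑ p : BasisIndex V, if h : (p.1 : ℕ) = k then
    c p x • ⟨B.natBasis p, h ▸ B.natBasis_mem p⟩ else 0
  have h1 : F.cls x k Z = ∑ p : BasisIndex V, if (p.1 : ℕ) = k then
      c p x • F.cls x p.1 ⟨B.natBasis p, B.natBasis_mem p⟩ else 0 := by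
    rw [map_sum]
    refine Finset.sum_congr rfl fun p _ => ?_
    split_ifs with h
    · rw [map_smul]
      congr 1
      exact WeightedSubRiem.cls_congr h.symm rfl
    · exact map_zero _
  rw [← h1, ← sub_eq_zero, ← map_sub]
  refine WeightedSubRiem.cls_eq_zero _ ?_
  have h2 : (Y - Z).1 = ∑ p : BasisIndex V, (c p • B.natBasis p -
      if (p.1 : ℕ) = k then c p x • B.natBasis p else 0) := by
    rw [Finset.sum_sub_distrib, ← hY]
    simp only [Z, AddSubgroupClass.coe_sub, Submodule.coe_sum]
    congr 1
    refine Finset.sum_congr rfl fun p _ => ?_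
    split_ifs <;> rfl
  rw [h2]
  refine Submodule.sum_mem _ fun p _ => ?_
  split_ifs with h
  · refine Submodule.mem_sup_right ?_
    have hf : c p - algebraMap ℝ (SmoothFun E M) (c p x) ∈ vanishIdeal (E := E) x := by
      change c p x - c p x = 0
      exact sub_self _
    have h3 := Submodule.smul_mem_smul hf (h ▸ B.natBasis_mem p : B.natBasis p ∈ F.mod k)
    rwa [sub_smul, algebraMap_smul] at h3
  · rw [sub_zero]
    rcases lt_or_ge k (p.1 : ℕ) with hkp | hkp
    · rw [hc p hkp, zero_smul]
      exact zero_mem _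
    · exact Submodule.mem_sup_left
        (Submodule.smul_mem _ _ (F.mono (by omega) (B.natBasis_mem p)))

attribute [local instance] LieRing.ofAssociativeRing

variable (V) in
/-- The bilinear maps `V × V → V` with smooth coefficients that are polynomial in `t`. -/
structure SmoothBilin (E M : Type*) [NormedAddCommGroup E] [NormedSpace ℝ E] [TopologicalSpace M]
    [ChartedSpace E M] where
  ι : Type
  [fintype : Fintype ι]
  exponent : ι → ℕ
  coeff : ι → SmoothFun E M
  map : ι → (∀ i, V i) →ₗ[ℝ] (∀ i, V i) →ₗ[ℝ] (∀ i, V i)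

attribute [instance] SmoothBilin.fintype

/-- The value of a family of bilinear maps at the point `y` and the time `t`. -/
def SmoothBilin.at (C : SmoothBilin V E M) (y : M) (t : ℝ) :
    (∀ i, V i) →ₗ[ℝ] (∀ i, V i) →ₗ[ℝ] (∀ i, V i) :=
  ∑ s, (t ^ C.exponent s * C.coeff s y) • C.map s

/-- The Lie bracket of vector fields lifts to a smooth family of bilinear maps on `V`, which for
`t = 0` lifts the bracket of the osculating Lie algebra. -/
theorem exists_bracket_lift : ∃ C : SmoothBilin V E M,
    (∀ y t u v, B.natAt y t (C.at y t u v) = evalVF y ⁅B.natT t u, B.natT t v⁆) ∧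
    ∀ x u v, B.natZero x (C.at x 0 u v) = ⁅B.natZero x u, B.natZero x v⁆ := by
  have hex : ∀ p q : BasisIndex V, ∃ c : BasisIndex V → SmoothFun E M,
      (∀ r : BasisIndex V, (p.1 : ℕ) + q.1 < r.1 → c r = 0) ∧
      ⁅B.natBasis p, B.natBasis q⁆ = ∑ r, c r • B.natBasis r := by
    intro p q
    have hmem := F.lie_mem _ _ _ (B.natBasis_mem p) _ (B.natBasis_mem q)
    have hp := p.1.2
    by_cases h : (p.1 : ℕ) + q.1 ≤ N
    · exact B.exists_coeff ⟨by have := hp.1; omega, h⟩ hmem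
    · obtain ⟨c, -, hc⟩ := B.exists_coeff (k := N) ⟨hp.1.trans hp.2, le_rfl⟩
        (Y := ⁅B.natBasis p, B.natBasis q⁆) (by rw [F.mod_eq_top N le_rfl]; trivial)
      exact ⟨c, fun r hr => by have := r.1.2.2; omega, hc⟩
  choose c hc0 hc using hex
  let e := homBasis V
  -- The field of degree `k` in the bracket of fields of degrees `i` and `j` gets the factor
  -- `t ^ (i + j - k)`, since `♮_t` supplies `t ^ k` on the left and `t ^ (i + j)` on the right of
  -- the bracket relation. The truncated subtraction is harmless: the coefficients with `k > i + j`
  -- vanish. For `t = 0` the terms with `k = i + j` remain.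
  let C : SmoothBilin V E M :=
    { ι := BasisIndex V × BasisIndex V × BasisIndex V
      exponent := fun s => (s.1.1 : ℕ) + s.2.1.1 - s.2.2.1
      coeff := fun s => c s.1 s.2.1 s.2.2
      map := fun s => (e.coord s.1).smulRight ((e.coord s.2.1).smulRight (e s.2.2)) }
  have hC : ∀ y t p q, C.at y t (e p) (e q) =
      ∑ r : BasisIndex V, (t ^ ((p.1 : ℕ) + q.1 - r.1) * c p q r y) • e r := by
    intro y t p q
    simp only [SmoothBilin.at, LinearMap.sum_apply]
    rw [Fintype.sum_prod_type, Finset.sum_eq_single p, Fintype.sum_prod_type,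
      Finset.sum_eq_single q]
    · simp [C]
    · intro q' _ hq
      simp [C, Finsupp.single_eq_of_ne hq]
    · simp
    · intro p' _ hp
      simp [C, Finsupp.single_eq_of_ne hp]
    · simp
  refine ⟨C, fun y t => ?_, fun x => ?_⟩
  · suffices h : (C.at y t).compr₂ (B.natAt y t) =
        ((LieAlgebra.ad ℝ (VField E M)).toLinearMap.compl₁₂ (B.natT t) (B.natT t)).compr₂
          (evalVF y) from fun u v => LinearMap.congr_fun₂ h u v
    refine e.ext fun p => e.ext fun q => ?_
    change B.natAt y t (C.at y t (e p) (e q)) = evalVF y ⁅B.natT t (e p), B.natT t (e q)⁆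
    rw [hC, natT_homBasis, natT_homBasis, smul_lie, lie_smul, hc, map_sum, map_smul, map_smul,
      map_sum, Finset.smul_sum, Finset.smul_sum]
    refine Finset.sum_congr rfl fun r _ => ?_
    rw [map_smul, natAt, LinearMap.comp_apply, natT_homBasis, map_smul]
    change _ = _ • _ • (c p q r y • evalVF y (B.natBasis r))
    rcases lt_or_ge ((p.1 : ℕ) + q.1) r.1 with h | h
    · rw [hc0 p q r h]
      simp
    · rw [smul_smul, smul_smul, smul_smul, ← pow_add]
      congr 1
      rw [mul_right_comm, ← pow_add, Nat.sub_add_cancel h]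
  · suffices h : (C.at x 0).compr₂ (B.natZero x) =
        (LieAlgebra.ad ℝ (F.Osc x)).toLinearMap.compl₁₂ (B.natZero x) (B.natZero x) from
      fun u v => LinearMap.congr_fun₂ h u v
    refine e.ext fun p => e.ext fun q => ?_
    change B.natZero x (C.at x 0 (e p) (e q)) = ⁅B.natZero x (e p), B.natZero x (e q)⁆
    rw [hC, natZero_homBasis, natZero_homBasis, WeightedSubRiem.lie_cls p.1.2.1 q.1.2.1,
      B.cls_eq_of_coeff x _ (hc0 p q) (hc p q), map_sum]
    refine Finset.sum_congr rfl fun r _ => ?_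
    rw [map_smul, natZero_homBasis]
    split_ifs with h
    · rw [show (p.1 : ℕ) + q.1 - r.1 = 0 by omega, pow_zero, one_mul]
    · rcases lt_or_ge ((p.1 : ℕ) + q.1) r.1 with h' | h'
      · rw [hc0 p q r h']
        simp
      · rw [zero_pow (by omega), zero_mul, zero_smul]

end GradedBasis

end Lift

/-! ### Limit subspaces are Lie subalgebras -/

section Subalgebra

theorem continuous_bilin {W U : Type*} [NormedAddCommGroup W] [NormedSpace ℝ W]
    [FiniteDimensional ℝ W] [NormedAddCommGroup U] [NormedSpace ℝ U] (T : W →ₗ[ℝ] W →ₗ[ℝ] U) :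
    Continuous fun p : W × W => T p.1 p.2 := by
  let T' : W →L[ℝ] W →L[ℝ] U := LinearMap.toContinuousLinearMap
    ((LinearMap.toContinuousLinearMap (𝕜 := ℝ) (E := W) (F' := U)).toLinearMap ∘ₗ T)
  exact (T'.continuous.comp continuous_fst).clm_apply continuous_snd

theorem tendsto_clm_apply {α W U : Type*} [NormedAddCommGroup W] [NormedSpace ℝ W]
    [NormedAddCommGroup U] [NormedSpace ℝ U] {l : Filter α} {f : α → W →L[ℝ] U} {g : α → W}
    {f₀ : W →L[ℝ] U} {g₀ : W} (hf : Filter.Tendsto f l (𝓝 f₀)) (hg : Filter.Tendsto g l (𝓝 g₀)) :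
    Filter.Tendsto (fun a => f a (g a)) l (𝓝 (f₀ g₀)) :=
  (isBoundedBilinearMap_apply.continuous.tendsto (f₀, g₀)).comp (hf.prodMk_nhds hg)

/-- A vector in the kernel of a surjective linear map can be moved continuously into the kernels of
the nearby maps. -/
theorem exists_tendsto_mem_ker {W : Type*} [NormedAddCommGroup W] [NormedSpace ℝ W]
    [FiniteDimensional ℝ W] {d : ℕ} (f₀ : W →L[ℝ] (Fin d → ℝ)) (hf₀ : Function.Surjective f₀)
    (w : W) (hw : f₀ w = 0) : ∃ r : (W →L[ℝ] (Fin d → ℝ)) → W,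
      Filter.Tendsto r (𝓝 f₀) (𝓝 w) ∧ ∀ᶠ f in 𝓝 f₀, f (r f) = 0 := by
  obtain ⟨σ', hσ'⟩ := (f₀ : W →ₗ[ℝ] (Fin d → ℝ)).exists_rightInverse_of_surjective
    (LinearMap.range_eq_top.2 hf₀)
  let σ : (Fin d → ℝ) →L[ℝ] W := LinearMap.toContinuousLinearMap σ'
  have hσ : f₀.comp σ = 1 := ContinuousLinearMap.ext fun v => LinearMap.congr_fun hσ' v
  have hc : Continuous fun f : W →L[ℝ] (Fin d → ℝ) => f.comp σ :=
    continuous_id.clm_comp continuous_const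
  have hinv : Filter.Tendsto (fun f : W →L[ℝ] (Fin d → ℝ) => Ring.inverse (f.comp σ)) (𝓝 f₀)
      (𝓝 1) := by
    have h1 := NormedRing.inverse_continuousAt (1 : ((Fin d → ℝ) →L[ℝ] (Fin d → ℝ))ˣ)
    have h2 : Filter.Tendsto (fun f : W →L[ℝ] (Fin d → ℝ) => f.comp σ) (𝓝 f₀) (𝓝 1) := by
      rw [← hσ]
      exact hc.continuousAt
    have h3 := h1.tendsto.comp h2
    rwa [Units.val_one, Ring.inverse_one] at h3
  refine ⟨fun f => w - σ (Ring.inverse (f.comp σ) (f w)), ?_, ?_⟩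
  · have h4 : Filter.Tendsto (fun f : W →L[ℝ] (Fin d → ℝ) => f w) (𝓝 f₀) (𝓝 (f₀ w)) :=
      (continuous_id.clm_apply continuous_const).continuousAt
    have h5 := (σ.continuous.tendsto _).comp (tendsto_clm_apply hinv h4)
    have h6 := (tendsto_const_nhds (x := w)).sub h5
    simpa [hw] using h6
  · have hu : ∀ᶠ f : W →L[ℝ] (Fin d → ℝ) in 𝓝 f₀, IsUnit (f.comp σ) := by
      refine hc.continuousAt.eventually (Units.isOpen.mem_nhds ?_)
      change IsUnit (f₀.comp σ)
      rw [hσ]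
      exact isUnit_one
    filter_upwards [hu] with f hf
    have := DFunLike.congr_fun (Ring.mul_inverse_cancel _ hf) (f w)
    rw [map_sub, sub_eq_zero]
    exact this.symm

variable {E : Type*} [NormedAddCommGroup E] [NormedSpace ℝ E]
  {M : Type*} [TopologicalSpace M] [ChartedSpace E M]
  {N : ℕ} {V : Set.Icc 1 N → Type*} [∀ i, NormedAddCommGroup (V i)] [∀ i, NormedSpace ℝ (V i)]
  [∀ i, FiniteDimensional ℝ (V i)]

namespace GradedBasis

theorem SmoothBilin.tendsto_at {α : Type*} {l : Filter α} (C : SmoothBilin V E M) {y : α → M}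
    {t : α → ℝ} {u v : α → ∀ i, V i} {y₀ : M} {t₀ : ℝ} {u₀ v₀ : ∀ i, V i}
    (hy : Filter.Tendsto y l (𝓝 y₀)) (ht : Filter.Tendsto t l (𝓝 t₀))
    (hu : Filter.Tendsto u l (𝓝 u₀)) (hv : Filter.Tendsto v l (𝓝 v₀)) :
    Filter.Tendsto (fun a => C.at (y a) (t a) (u a) (v a)) l (𝓝 (C.at y₀ t₀ u₀ v₀)) := by
  simp only [SmoothBilin.at, LinearMap.sum_apply, LinearMap.smul_apply]
  refine tendsto_finsetSum _ fun s _ => Filter.Tendsto.smul ?_ ?_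
  · exact (ht.pow _).mul (((C.coeff s).contMDiff.continuous.tendsto y₀).comp hy)
  · exact ((continuous_bilin (C.map s)).tendsto (u₀, v₀)).comp (hu.prodMk_nhds hv)

variable [FiniteDimensional ℝ E] [IsManifold 𝓘(ℝ, E) ∞ M] {F : WeightedSubRiem E M N}
  (B : GradedBasis F V)

theorem evalVF_lie_eq_zero {y : M} {X Y : VField E M} (hX : evalVF y X = 0) (hY : evalVF y Y = 0) :
    evalVF y ⁅X, Y⁆ = 0 := by
  have h := VectorField.mlieBracketWithin_eq_zero_of_eq_zero (I := 𝓘(ℝ, E)) (V := X) (W := Y)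
    (s := Set.univ) (x := y) hX hY
  rwa [VectorField.mlieBracketWithin_univ] at h

/-- The bracket of two vector fields vanishing at `y` vanishes at `y`, so that the lifted bracket
preserves the subspaces `ker ♮_{y,t}`. This passes to the limit. -/
theorem lie_mem_of_mem_limitSubspaces [T2Space M] {x : M} {L : F.GrassAt x}
    (hL : L ∈ B.limitSubspaces x) {u v : F.Osc x} (hu : u ∈ L.1) (hv : v ∈ L.1) :
    ⁅u, v⁆ ∈ L.1 := by
  obtain ⟨f₀, hf₀, hk, hcl⟩ := (B.mem_limitSubspaces_iff L).1 hL
  obtain ⟨C, hC, hC0⟩ := B.exists_bracket_lift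
  obtain ⟨u, rfl⟩ := B.natZero_surjective x u
  obtain ⟨v, rfl⟩ := B.natZero_surjective x v
  have hker : ∀ w, f₀ w = 0 ↔ B.natZero x w ∈ L.1 := fun w => by
    rw [← Submodule.mem_comap, ← hk]
    rfl
  obtain ⟨r, hr, hr0⟩ := exists_tendsto_mem_ker f₀ hf₀ u ((hker u).2 hu)
  obtain ⟨s, hs, hs0⟩ := exists_tendsto_mem_ker f₀ hf₀ v ((hker v).2 hv)
  rw [← hC0, ← hker]
  have h1 : Filter.Tendsto (fun p : ((∀ i, V i) →L[ℝ] (Fin (Module.finrank ℝ E) → ℝ)) × M × ℝ =>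
      p.1 (C.at p.2.1 p.2.2 (r p.1) (s p.1))) (𝓝 (f₀, x, 0)) (𝓝 (f₀ (C.at x 0 u v))) := by
    have hfst : Filter.Tendsto
        (fun p : ((∀ i, V i) →L[ℝ] (Fin (Module.finrank ℝ E) → ℝ)) × M × ℝ => p.1)
        (𝓝 (f₀, x, 0)) (𝓝 f₀) := continuous_fst.continuousAt
    have hsnd : Filter.Tendsto
        (fun p : ((∀ i, V i) →L[ℝ] (Fin (Module.finrank ℝ E) → ℝ)) × M × ℝ => p.2)
        (𝓝 (f₀, x, 0)) (𝓝 (x, 0)) := continuous_snd.continuousAt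
    exact tendsto_clm_apply hfst (C.tendsto_at ((continuous_fst.tendsto _).comp hsnd)
      ((continuous_snd.tendsto _).comp hsnd) (hr.comp hfst) (hs.comp hfst))
  refine tendsto_nhds_unique_of_frequently_eq h1 (tendsto_const_nhds (x := 0)) ?_
  have h2 : ∃ᶠ p in 𝓝 (f₀, x, (0 : ℝ)), p ∈ B.kerGraph := mem_closure_iff_frequently.1 hcl
  have h3 : ∀ᶠ p : ((∀ i, V i) →L[ℝ] (Fin (Module.finrank ℝ E) → ℝ)) × M × ℝ in
      𝓝 (f₀, x, (0 : ℝ)), p.1 (r p.1) = 0 ∧ p.1 (s p.1) = 0 :=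
    (Continuous.tendsto continuous_fst (f₀, x, (0 : ℝ))).eventually (hr0.and hs0)
  refine (h2.and_eventually h3).mono ?_
  rintro ⟨f, y, t⟩ ⟨⟨-, hf⟩, h4, h5⟩
  have hf' : ∀ w, f w = 0 ↔ B.natAt y t w = 0 := fun w => Submodule.ext_iff.1 hf w
  refine (hf' _).2 ?_
  rw [hC]
  exact evalVF_lie_eq_zero ((hf' _).1 h4) ((hf' _).1 h5)

end GradedBasis

end Subalgebra

/-! ### Transporting kernels along a flow -/

section Flow

/-- A `C¹` vector field has a local flow, continuous in space and time, that stays for a short time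
in a given neighbourhood of the starting point. -/
theorem exists_local_flow {Q : Type*} [NormedAddCommGroup Q] [NormedSpace ℝ Q] [CompleteSpace Q]
    {f : Q → Q} {q₀ : Q} (hf : ContDiffAt ℝ 1 f q₀) {O : Set Q} (hO : O ∈ 𝓝 q₀) :
    ∃ ε > 0, ∃ α : Q × ℝ → Q, ∃ U ∈ 𝓝 q₀, (∀ q ∈ U, α (q, 0) = q ∧ ∀ s ∈ Set.Icc 0 ε,
      HasDerivWithinAt (fun s => α (q, s)) (f (α (q, s))) (Set.Icc 0 ε) s ∧ α (q, s) ∈ O) ∧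
      ContinuousOn α (U ×ˢ Set.Icc 0 ε) := by
  obtain ⟨ε, hε, a, r, _, _, hr, hpl⟩ := IsPicardLindelof.of_contDiffAt_one hf
  obtain ⟨α, hα, hc⟩ :=
    (hpl 0).exists_forall_mem_closedBall_eq_hasDerivWithinAt_continuousOn
  have hr' : (0 : ℝ) < r := by exact_mod_cast hr
  have hnhds : Metric.closedBall q₀ r ×ˢ Set.Icc (0 - ε) (0 + ε) ∈ 𝓝 (q₀, (0 : ℝ)) :=
    prod_mem_nhds (Metric.closedBall_mem_nhds _ hr') (Icc_mem_nhds (by linarith) (by linarith))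
  have hα0 : α (q₀, 0) = q₀ := (hα q₀ (Metric.mem_closedBall_self hr'.le)).1
  have hpre : α ⁻¹' O ∈ 𝓝 (q₀, (0 : ℝ)) :=
    (hc.continuousAt hnhds).preimage_mem_nhds (by rwa [hα0])
  obtain ⟨A, hA, T, hT, hAT⟩ := mem_nhds_prod_iff.1 hpre
  obtain ⟨δ, hδ, hδT⟩ := Metric.nhds_basis_closedBall.mem_iff.1 hT
  have hsub : Set.Icc 0 (min δ ε) ⊆ Set.Icc (0 - ε) (0 + ε) :=
    Set.Icc_subset_Icc (by linarith) (by rw [zero_add]; exact min_le_right _ _)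
  refine ⟨min δ ε, lt_min hδ hε, α, A ∩ Metric.closedBall q₀ r,
    Filter.inter_mem hA (Metric.closedBall_mem_nhds _ hr'), fun q hq => ⟨(hα q hq.2).1,
      fun s hs => ⟨((hα q hq.2).2 s (hsub hs)).mono hsub, hAT ⟨hq.1, hδT ?_⟩⟩⟩,
    hc.mono (Set.prod_mono Set.inter_subset_right hsub)⟩
  rw [Metric.mem_closedBall, Real.dist_eq, sub_zero, abs_of_nonneg hs.1]
  exact hs.2.trans (min_le_left _ _)

variable {E W : Type*} [NormedAddCommGroup E] [NormedSpace ℝ E]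
  [NormedAddCommGroup W] [NormedSpace ℝ W]

/-- Let `h z : W → E` be a family of linear maps, so that `w ↦ h · w` is a space of vector fields on
`U`, and suppose that `[h · g, h · w] = h · (A w)`. Along an integral curve of `h · g` the solutions
of `Φ' = - A Φ` preserve the kernels of the maps `h z`: by the bracket relation
`ξ = h z (Φ v)` solves the linearized equation of the curve. -/
theorem apply_eq_zero_of_integral_curve {U : Set E} (hU : IsOpen U) {h : E → W →L[ℝ] E}
    {A : E → W →L[ℝ] W} (hh : ContDiffOn ℝ 1 h U) {g : W}
    (hbr : ∀ z ∈ U, ∀ v, fderiv ℝ (fun z => h z v) z (h z g) -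
      fderiv ℝ (fun z => h z g) z (h z v) = h z (A z v))
    {ε : ℝ} {z : ℝ → E} {Φ : ℝ → W →L[ℝ] W} (hzU : ∀ s ∈ Set.Icc 0 ε, z s ∈ U)
    (hz : ∀ s ∈ Set.Icc 0 ε, HasDerivWithinAt z (h (z s) g) (Set.Icc 0 ε) s)
    (hΦ : ∀ s ∈ Set.Icc 0 ε, HasDerivWithinAt Φ (-(A (z s) ∘L Φ s)) (Set.Icc 0 ε) s)
    {v : W} (hv : h (z 0) (Φ 0 v) = 0) : ∀ s ∈ Set.Icc 0 ε, h (z s) (Φ s v) = 0 := by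
  have hdiff : ∀ y ∈ U, HasFDerivAt h (fderiv ℝ h y) y := fun y hy =>
    ((hh.contDiffAt (hU.mem_nhds hy)).differentiableAt (by simp)).hasFDerivAt
  have hfd : ∀ y ∈ U, ∀ w e, fderiv ℝ (fun z => h z w) y e = fderiv ℝ h y e w := fun y hy w e => by
    rw [((hdiff y hy).clm_apply (hasFDerivAt_const w y)).fderiv]
    simp
  have hder : ∀ s ∈ Set.Icc 0 ε, HasDerivWithinAt (fun s => h (z s) (Φ s v))
      (fderiv ℝ h (z s) (h (z s) (Φ s v)) g) (Set.Icc 0 ε) s := by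
    intro s hs
    have h1 : HasDerivWithinAt (fun s => h (z s)) (fderiv ℝ h (z s) (h (z s) g))
        (Set.Icc 0 ε) s := (hdiff _ (hzU s hs)).comp_hasDerivWithinAt s (hz s hs)
    have h2 := h1.clm_apply ((hΦ s hs).clm_apply (hasDerivWithinAt_const s (Set.Icc 0 ε) v))
    convert! h2 using 1
    have h3 := hbr (z s) (hzU s hs) (Φ s v)
    rw [hfd _ (hzU s hs), hfd _ (hzU s hs)] at h3
    simp only [neg_apply, ContinuousLinearMap.comp_apply, map_zero, add_zero,
      map_neg, ← h3]
    abel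
  have hzc : ContinuousOn z (Set.Icc 0 ε) := fun s hs => (hz s hs).continuousWithinAt
  have hfc : ContinuousOn (fun s => fderiv ℝ h (z s)) (Set.Icc 0 ε) :=
    (hh.continuousOn_fderiv_of_isOpen hU le_rfl).comp hzc hzU
  obtain ⟨K, hK⟩ := isCompact_Icc.exists_bound_of_continuousOn (E := E →L[ℝ] W →L[ℝ] E) hfc
  refine eq_zero_of_abs_deriv_le_mul_abs_self_of_eq_zero_right (K := K * ‖g‖)
    (fun s hs => (hder s hs).continuousWithinAt)
    (fun s hs => (hder s (Set.Ico_subset_Icc_self hs)).mono_of_mem_nhdsWithin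
      (Icc_mem_nhdsGE_of_mem hs)) hv fun s hs => ?_
  have h4 := hK s (Set.Ico_subset_Icc_self hs)
  calc ‖fderiv ℝ h (z s) (h (z s) (Φ s v)) g‖
      ≤ ‖fderiv ℝ h (z s)‖ * ‖h (z s) (Φ s v)‖ * ‖g‖ :=
        (ContinuousLinearMap.le_opNorm _ _).trans
          (mul_le_mul_of_nonneg_right (ContinuousLinearMap.le_opNorm _ _) (norm_nonneg _))
    _ ≤ K * ‖h (z s) (Φ s v)‖ * ‖g‖ := by gcongr
    _ = K * ‖g‖ * ‖h (z s) (Φ s v)‖ := by ring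

theorem eq_exp_of_hasDerivWithinAt {A : Type*} [NormedRing A] [NormedAlgebra ℝ A] [CompleteSpace A]
    {a : A} {ε : ℝ} {Φ : ℝ → A} (h0 : Φ 0 = 1)
    (hΦ : ∀ s ∈ Set.Icc 0 ε, HasDerivWithinAt Φ (a * Φ s) (Set.Icc 0 ε) s) :
    ∀ s ∈ Set.Icc 0 ε, Φ s = NormedSpace.exp (s • a) := by
  have hder : ∀ s ∈ Set.Icc 0 ε, HasDerivWithinAt (fun s => NormedSpace.exp (s • a) - Φ s)
      (a * (NormedSpace.exp (s • a) - Φ s)) (Set.Icc 0 ε) s := fun s hs => by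
    rw [mul_sub]
    exact (hasDerivAt_exp_smul_const' a s).hasDerivWithinAt.sub (hΦ s hs)
  intro s hs
  refine (sub_eq_zero.1 (eq_zero_of_abs_deriv_le_mul_abs_self_of_eq_zero_right (K := ‖a‖)
    (fun s hs => (hder s hs).continuousWithinAt)
    (fun s hs => (hder s (Set.Ico_subset_Icc_self hs)).mono_of_mem_nhdsWithin
      (Icc_mem_nhdsGE_of_mem hs)) (by simp [h0]) (fun s _ => norm_mul_le _ _) s hs)).symm

/-- The flow of `h (t, ·) g`, together with the solution `Φ` of `Φ' = - A Φ`, depends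
continuously on the initial point and on the parameter `t`, and preserves the kernels of `h`. If
the vector fields vanish for `t = 0`, the flow is stationary there and `Φ` is an exponential. -/
theorem exists_kernel_flow [FiniteDimensional ℝ E] [FiniteDimensional ℝ W] {U : Set E}
    (hU : IsOpen U) {h : ℝ × E → W →L[ℝ] E} {A : ℝ × E → W →L[ℝ] W}
    (hh : ContDiffOn ℝ 1 h (Set.univ ×ˢ U)) (hA : ContDiffOn ℝ 1 A (Set.univ ×ˢ U)) {g : W}
    (hbr : ∀ t, ∀ z ∈ U, ∀ v, fderiv ℝ (fun z => h (t, z) v) z (h (t, z) g) -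
      fderiv ℝ (fun z => h (t, z) g) z (h (t, z) v) = h (t, z) (A (t, z) v))
    {z₀ : E} (hz₀ : z₀ ∈ U) (h0 : ∀ z ∈ U, h (0, z) = 0) :
    ∃ ε > (0 : ℝ), ∀ s ∈ Set.Icc 0 ε, ∃ (ζ : ℝ × E → E) (Φ : ℝ × E → W →L[ℝ] W),
      ContinuousAt ζ (0, z₀) ∧ ContinuousAt Φ (0, z₀) ∧ ζ (0, z₀) = z₀ ∧
      Φ (0, z₀) = NormedSpace.exp (s • -A (0, z₀)) ∧
      ∀ᶠ p in 𝓝 (0, z₀), ζ p ∈ U ∧ ∀ v, h p v = 0 → h (p.1, ζ p) (Φ p v) = 0 := by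
  have : CompleteSpace E := FiniteDimensional.complete ℝ E
  have : CompleteSpace W := FiniteDimensional.complete ℝ W
  let f : ℝ × E × (W →L[ℝ] W) → ℝ × E × (W →L[ℝ] W) :=
    fun q => (0, h (q.1, q.2.1) g, -(A (q.1, q.2.1) ∘L q.2.2))
  let q₀ : ℝ × E × (W →L[ℝ] W) := (0, z₀, 1)
  have hUo : IsOpen ((Set.univ : Set ℝ) ×ˢ U) := isOpen_univ.prod hU
  have hpr : ContDiffAt ℝ 1 (fun q : ℝ × E × (W →L[ℝ] W) => (q.1, q.2.1)) q₀ := by fun_prop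
  have hmem : ((q₀.1, q₀.2.1) : ℝ × E) ∈ (Set.univ : Set ℝ) ×ˢ U := ⟨trivial, hz₀⟩
  have hh' := (hh.contDiffAt (hUo.mem_nhds hmem)).comp q₀ hpr
  have hA' := (hA.contDiffAt (hUo.mem_nhds hmem)).comp q₀ hpr
  have hf : ContDiffAt ℝ 1 f q₀ :=
    contDiffAt_const.prodMk ((hh'.clm_apply contDiffAt_const).prodMk
      (hA'.clm_comp (contDiffAt_snd.comp q₀ contDiffAt_snd)).neg)
  have hO : {q : ℝ × E × (W →L[ℝ] W) | q.2.1 ∈ U} ∈ 𝓝 q₀ :=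
    (hU.preimage (continuous_fst.comp continuous_snd)).mem_nhds hz₀
  obtain ⟨ε, hε, α, B, hB, hα, hc⟩ := exists_local_flow hf hO
  -- the parameter does not change along the flow
  have hcurve : ∀ q ∈ B, ∀ s ∈ Set.Icc 0 ε, (α (q, s)).1 = q.1 := by
    intro q hq s hs
    have h2 : ∀ s ∈ Set.Icc 0 ε, HasDerivWithinAt (fun s => (α (q, s)).1) 0 (Set.Icc 0 ε) s :=
      fun s hs => (ContinuousLinearMap.fst ℝ ℝ
        (E × (W →L[ℝ] W))).hasFDerivAt.comp_hasDerivWithinAt s ((hα q hq).2 s hs).1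
    have h1 := constant_of_has_deriv_right_zero (f := fun s => (α (q, s)).1) (a := 0) (b := ε)
      (fun s hs => (h2 s hs).continuousWithinAt)
      (fun s hs => (h2 s (Set.Ico_subset_Icc_self hs)).mono_of_mem_nhdsWithin
        (Icc_mem_nhdsGE_of_mem hs)) s hs
    rw [h1, (hα q hq).1]
  have hz : ∀ q ∈ B, ∀ s ∈ Set.Icc 0 ε, HasDerivWithinAt (fun s => (α (q, s)).2.1)
      (h (q.1, (α (q, s)).2.1) g) (Set.Icc 0 ε) s := fun q hq s hs => by
    have h2 := (ContinuousLinearMap.fst ℝ E (W →L[ℝ] W) ∘L ContinuousLinearMap.snd ℝ ℝ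
      (E × (W →L[ℝ] W))).hasFDerivAt.comp_hasDerivWithinAt s ((hα q hq).2 s hs).1
    rw [← hcurve q hq s hs]
    exact h2
  have hΦ : ∀ q ∈ B, ∀ s ∈ Set.Icc 0 ε, HasDerivWithinAt (fun s => (α (q, s)).2.2)
      (-(A (q.1, (α (q, s)).2.1) ∘L (α (q, s)).2.2)) (Set.Icc 0 ε) s := fun q hq s hs => by
    have h2 := (ContinuousLinearMap.snd ℝ E (W →L[ℝ] W) ∘L ContinuousLinearMap.snd ℝ ℝ
      (E × (W →L[ℝ] W))).hasFDerivAt.comp_hasDerivWithinAt s ((hα q hq).2 s hs).1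
    rw [← hcurve q hq s hs]
    exact h2
  have hq₀ : q₀ ∈ B := mem_of_mem_nhds hB
  have hstat : ∀ s ∈ Set.Icc 0 ε, (α (q₀, s)).2.1 = z₀ := by
    intro s hs
    have h1 := constant_of_has_deriv_right_zero (f := fun s => (α (q₀, s)).2.1) (a := 0) (b := ε)
      (fun s hs => (hz q₀ hq₀ s hs).continuousWithinAt)
      (fun s hs => by
        have h2 := hz q₀ hq₀ s (Set.Ico_subset_Icc_self hs)
        rw [show q₀.1 = 0 from rfl,
          h0 _ ((hα q₀ hq₀).2 s (Set.Ico_subset_Icc_self hs)).2] at h2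
        exact h2.mono_of_mem_nhdsWithin (Icc_mem_nhdsGE_of_mem hs)) s hs
    rw [h1, (hα q₀ hq₀).1]
  let j : ℝ × E → ℝ × E × (W →L[ℝ] W) := fun p => (p.1, p.2, 1)
  have hj : Continuous j := by fun_prop
  refine ⟨ε, hε, fun s hs => ⟨fun p => (α (j p, s)).2.1, fun p => (α (j p, s)).2.2, ?_⟩⟩
  have hαs : ContinuousAt (fun p => α (j p, s)) (0, z₀) := by
    have h1 : ContinuousAt (fun q => α (q, s)) q₀ :=
      ((hc.comp (by fun_prop) fun q hq => ⟨hq, hs⟩ :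
        ContinuousOn (fun q => α (q, s)) B)).continuousAt hB
    exact ContinuousAt.comp (f := j) (x := ((0 : ℝ), z₀)) h1 hj.continuousAt
  refine ⟨hαs.snd.fst, hαs.snd.snd, hstat s hs, ?_, ?_⟩
  · refine eq_exp_of_hasDerivWithinAt (a := -A (0, z₀)) (Φ := fun s => (α (q₀, s)).2.2)
      (by rw [(hα q₀ hq₀).1]) (fun s hs => ?_) s hs
    have h1 := hΦ q₀ hq₀ s hs
    rw [hstat s hs] at h1
    rw [neg_mul]
    exact h1
  · have hjB : ∀ᶠ p in 𝓝 ((0 : ℝ), z₀), j p ∈ B := hj.continuousAt.eventually hB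
    filter_upwards [hjB] with p hp
    refine ⟨((hα _ hp).2 s hs).2, fun v hv => ?_⟩
    have hsec : ContDiffOn ℝ 1 (fun z => h (p.1, z)) U :=
      hh.comp (by fun_prop) fun z hz => ⟨trivial, hz⟩
    refine apply_eq_zero_of_integral_curve hU (h := fun z => h (p.1, z))
      (A := fun z => A (p.1, z)) hsec (fun z hz v => hbr p.1 z hz v)
      (fun s hs => ((hα _ hp).2 s hs).2) (fun s hs => hz _ hp s hs) (fun s hs => hΦ _ hp s hs)
      ?_ s hs
    rw [(hα _ hp).1]
    exact hv

end Flow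

/-! ### Vector fields in a chart -/

section CoordAd

variable {E : Type*} [NormedAddCommGroup E] [NormedSpace ℝ E]
  {M : Type*} [TopologicalSpace M] [ChartedSpace E M]
  {N : ℕ} {V : Set.Icc 1 N → Type*} [∀ i, NormedAddCommGroup (V i)] [∀ i, NormedSpace ℝ (V i)]
  [∀ i, FiniteDimensional ℝ (V i)]

theorem contMDiffAt_chart_symm [IsManifold 𝓘(ℝ, E) ∞ M] {x : M} {z : E}
    (hz : z ∈ (extChartAt 𝓘(ℝ, E) x).target) :
    ContMDiffAt 𝓘(ℝ, E) 𝓘(ℝ, E) ∞ (extChartAt 𝓘(ℝ, E) x).symm z :=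
  (contMDiffOn_extChartAt_symm (I := 𝓘(ℝ, E)) x).contMDiffAt
    ((isOpen_extChartAt_target x).mem_nhds hz)

namespace GradedBasis

/-- The endomorphism `w ↦ C_{y,t}(g, w)` of `V`, in the preferred chart at `x`. -/
def SmoothBilin.coordAd (C : SmoothBilin V E M) (g : ∀ i, V i) (x : M) (p : ℝ × E) :
    (∀ i, V i) →L[ℝ] (∀ i, V i) :=
  ∑ s, (p.1 ^ C.exponent s * C.coeff s ((extChartAt 𝓘(ℝ, E) x).symm p.2)) •
    LinearMap.toContinuousLinearMap (C.map s g)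

theorem SmoothBilin.coordAd_apply (C : SmoothBilin V E M) (g : ∀ i, V i) (x : M) (p : ℝ × E)
    (v : ∀ i, V i) :
    C.coordAd g x p v = C.at ((extChartAt 𝓘(ℝ, E) x).symm p.2) p.1 g v := by
  simp [SmoothBilin.coordAd, SmoothBilin.at]

theorem SmoothBilin.contDiffOn_coordAd [IsManifold 𝓘(ℝ, E) ∞ M] (C : SmoothBilin V E M)
    (g : ∀ i, V i) (x : M) :
    ContDiffOn ℝ 1 (C.coordAd g x) (Set.univ ×ˢ (extChartAt 𝓘(ℝ, E) x).target) := by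
  refine ContDiffOn.sum fun s _ => ContDiffOn.smul
    ((contDiff_fst.pow _).contDiffOn.mul fun p hp => ?_) contDiffOn_const
  have h1 : ContDiffAt ℝ 1 (fun z => C.coeff s ((extChartAt 𝓘(ℝ, E) x).symm z)) p.2 :=
    ((C.coeff s).contMDiff.contMDiffAt.comp p.2 (contMDiffAt_chart_symm hp.2)).contDiffAt.of_le
      (by simp)
  exact (h1.comp p contDiffAt_snd).contDiffWithinAt

end GradedBasis

end CoordAd

section Chart

variable {E : Type*} [NormedAddCommGroup E] [NormedSpace ℝ E]
  {M : Type*} [TopologicalSpace M] [ChartedSpace E M] [IsManifold 𝓘(ℝ, E) ∞ M]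

/-- The value at `z` of the representation of a vector field in the preferred chart at `x`; a junk
value if `z` does not lie in the target of the chart. -/
def coordEval (x : M) (z : E) : VField E M →ₗ[ℝ] E :=
  (mfderiv 𝓘(ℝ, E) 𝓘(ℝ, E) (extChartAt 𝓘(ℝ, E) x).symm z).inverse.toLinearMap ∘ₗ
    evalVF ((extChartAt 𝓘(ℝ, E) x).symm z)

theorem isInvertible_mfderiv_chart_symm {x : M} {z : E} (hz : z ∈ (extChartAt 𝓘(ℝ, E) x).target) :
    (mfderiv 𝓘(ℝ, E) 𝓘(ℝ, E) (extChartAt 𝓘(ℝ, E) x).symm z).IsInvertible := by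
  have : IsManifold 𝓘(ℝ, E) 1 M := IsManifold.of_le (n := ∞) (by simp)
  have h := isInvertible_mfderivWithin_extChartAt_symm (I := 𝓘(ℝ, E)) hz
  rwa [ModelWithCorners.range_eq_univ, mfderivWithin_univ] at h

theorem coordEval_eq_zero_iff {x : M} {z : E} (hz : z ∈ (extChartAt 𝓘(ℝ, E) x).target)
    (X : VField E M) :
    coordEval x z X = 0 ↔ evalVF ((extChartAt 𝓘(ℝ, E) x).symm z) X = 0 := by
  obtain ⟨e, he⟩ := isInvertible_mfderiv_chart_symm hz
  change (mfderiv 𝓘(ℝ, E) 𝓘(ℝ, E) (extChartAt 𝓘(ℝ, E) x).symm z).inverse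
    (evalVF ((extChartAt 𝓘(ℝ, E) x).symm z) X) = 0 ↔ _
  rw [← he, ContinuousLinearMap.inverse_equiv]
  exact e.symm.map_eq_zero_iff

theorem contDiffAt_coordEval [CompleteSpace E] {x : M} {z : E}
    (hz : z ∈ (extChartAt 𝓘(ℝ, E) x).target)
    (X : VField E M) : ContDiffAt ℝ 1 (fun z => coordEval x z X) z := by
  have : IsManifold 𝓘(ℝ, E) 2 M := IsManifold.of_le (n := ∞) (by simpa using ENat.LEInfty.out)
  have : IsManifold 𝓘(ℝ, E) 1 M := IsManifold.of_le (n := ∞) (by simp)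
  exact contMDiffAt_vectorSpace_iff_contDiffAt.1 <|
    ContMDiffAt.mpullback_vectorField_preimage (n := 2) (X.contMDiff.contMDiffAt.of_le (by simp))
      ((contMDiffAt_chart_symm hz).of_le (by simpa using ENat.LEInfty.out))
      (isInvertible_mfderiv_chart_symm hz) (by norm_num)

theorem coordEval_lie [FiniteDimensional ℝ E] {x : M} {z : E}
    (hz : z ∈ (extChartAt 𝓘(ℝ, E) x).target) (X Y : VField E M) :
    coordEval x z ⁅X, Y⁆ = fderiv ℝ (fun z => coordEval x z Y) z (coordEval x z X) -
      fderiv ℝ (fun z => coordEval x z X) z (coordEval x z Y) := by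
  have : IsManifold 𝓘(ℝ, E) (minSmoothness ℝ 2) M :=
    IsManifold.of_le (n := ∞) (by simpa using ENat.LEInfty.out)
  have : CompleteSpace E := FiniteDimensional.complete ℝ E
  have h := VectorField.mpullback_mlieBracket (I := 𝓘(ℝ, E)) (I' := 𝓘(ℝ, E))
    (f := (extChartAt 𝓘(ℝ, E) x).symm) (x₀ := z) (V := X) (W := Y) (n := minSmoothness ℝ 2)
    X.mdifferentiableAt Y.mdifferentiableAt
    ((contMDiffAt_chart_symm hz).of_le (by simpa using ENat.LEInfty.out)) le_rfl
  have h1 : VectorField.mlieBracketWithin 𝓘(ℝ, E) (fun z => coordEval x z X)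
      (fun z => coordEval x z Y) Set.univ z =
      VectorField.mlieBracket 𝓘(ℝ, E) (fun z => coordEval x z X) (fun z => coordEval x z Y) z :=
    congrFun VectorField.mlieBracketWithin_univ z
  have h2 := congrFun (VectorField.mlieBracketWithin_eq_lieBracketWithin (𝕜 := ℝ)
    (V := fun z => coordEval x z X) (W := fun z => coordEval x z Y) (s := Set.univ)) z
  have h3 : VectorField.lieBracketWithin ℝ (fun z => coordEval x z X) (fun z => coordEval x z Y)
      Set.univ z =
      VectorField.lieBracket ℝ (fun z => coordEval x z X) (fun z => coordEval x z Y) z :=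
    congrFun VectorField.lieBracketWithin_univ z
  exact h.trans (h1.symm.trans (h2.trans h3))

variable [FiniteDimensional ℝ E] {N : ℕ} {F : WeightedSubRiem E M N}
  {V : Set.Icc 1 N → Type*} [∀ i, NormedAddCommGroup (V i)] [∀ i, NormedSpace ℝ (V i)]
  [∀ i, FiniteDimensional ℝ (V i)] (B : GradedBasis F V)

namespace GradedBasis

/-- The maps `♮_{y,t}` in the preferred chart at `x`. -/
def coordNat (x : M) (p : ℝ × E) : (∀ i, V i) →L[ℝ] E :=
  ∑ i : BasisIndex V, p.1 ^ (i.1 : ℕ) •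
    (LinearMap.toContinuousLinearMap ((homBasis V).coord i)).smulRight
      (coordEval x p.2 (B.natBasis i))

theorem coordNat_apply (x : M) (p : ℝ × E) (v : ∀ i, V i) :
    B.coordNat x p v = coordEval x p.2 (B.natT p.1 v) := by
  conv_rhs => rw [← (homBasis V).sum_repr v, map_sum, map_sum]
  rw [coordNat, _root_.sum_apply]
  refine Finset.sum_congr rfl fun i _ => ?_
  rw [map_smul, natT_homBasis, map_smul, map_smul, smul_comm]
  rfl

theorem coordNat_apply_eq_zero_iff {x : M} {t : ℝ} {z : E}
    (hz : z ∈ (extChartAt 𝓘(ℝ, E) x).target) (v : ∀ i, V i) :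
    B.coordNat x (t, z) v = 0 ↔ B.natAt ((extChartAt 𝓘(ℝ, E) x).symm z) t v = 0 := by
  rw [coordNat_apply, coordEval_eq_zero_iff hz]
  rfl

theorem coordNat_zero (x : M) (z : E) : B.coordNat x (0, z) = 0 := by
  refine Finset.sum_eq_zero fun i _ => ?_
  rw [zero_pow (by have := i.1.2.1; omega), zero_smul]

theorem contDiffOn_coordNat (x : M) :
    ContDiffOn ℝ 1 (B.coordNat x) (Set.univ ×ˢ (extChartAt 𝓘(ℝ, E) x).target) := by
  have : CompleteSpace E := FiniteDimensional.complete ℝ E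
  refine ContDiffOn.sum fun i _ => ((contDiff_fst.pow _).contDiffOn).smul ?_
  have h1 : ContDiffOn ℝ 1 (fun p : ℝ × E => coordEval x p.2 (B.natBasis i))
      (Set.univ ×ˢ (extChartAt 𝓘(ℝ, E) x).target) := fun p hp =>
    ((contDiffAt_coordEval hp.2 (B.natBasis i)).comp p contDiffAt_snd).contDiffWithinAt
  exact contDiffOn_const.smulRight h1

/-- The bracket relation `[♮_t(g), ♮_t(v)] = ♮_t(C_t(g, v))` in a chart. -/
theorem coordNat_bracket {C : SmoothBilin V E M}
    (hC : ∀ y t u v, B.natAt y t (C.at y t u v) = evalVF y ⁅B.natT t u, B.natT t v⁆)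
    (x : M) (t : ℝ) {z : E} (hz : z ∈ (extChartAt 𝓘(ℝ, E) x).target) (g v : ∀ i, V i) :
    fderiv ℝ (fun z => B.coordNat x (t, z) v) z (B.coordNat x (t, z) g) -
      fderiv ℝ (fun z => B.coordNat x (t, z) g) z (B.coordNat x (t, z) v) =
      B.coordNat x (t, z) (C.coordAd g x (t, z) v) := by
  simp only [coordNat_apply, SmoothBilin.coordAd_apply]
  rw [← coordEval_lie hz, ← sub_eq_zero, ← map_sub, coordEval_eq_zero_iff hz, map_sub, ← hC]
  exact sub_self _

end GradedBasis

end Chart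

/-! ### Conjugation acts on the limit subspaces -/

section Conjugation

/-- A linear map that intertwines `T` with a nilpotent endomorphism `S` intertwines their
exponentials; for `S` the exponential series is finite. -/
theorem map_exp_eq_texp {W O : Type*} [NormedAddCommGroup W] [NormedSpace ℝ W]
    [FiniteDimensional ℝ W] [AddCommGroup O] [Module ℝ O] (π : W →ₗ[ℝ] O) (T : W →L[ℝ] W)
    (S : Module.End ℝ O) (hTS : ∀ w, π (T w) = S (π w)) {K : ℕ} (hS : S ^ K = 0) (w : W) :
    π (NormedSpace.exp T w) = texp K S (π w) := by
  have : CompleteSpace W := FiniteDimensional.complete ℝ W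
  have hpow : ∀ n, π ((T ^ n) w) = (S ^ n) (π w) := by
    intro n
    induction n with
    | zero => rfl
    | succ n ih =>
      rw [pow_succ', pow_succ', mul_apply_eq_comp, Module.End.mul_apply, hTS, ih]
  have hsum : HasSum (fun n : ℕ => ((n.factorial : ℝ)⁻¹) • (T ^ n) w) (NormedSpace.exp T w) :=
    (NormedSpace.exp_series_hasSum_exp' (𝕂 := ℝ) T).mapL (ContinuousLinearMap.apply ℝ W w)
  -- the remainder of the series lies in the kernel of `π`, which is closed
  have hmem : NormedSpace.exp T w - ∑ n ∈ Finset.range K, ((n.factorial : ℝ)⁻¹) • (T ^ n) w ∈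
      LinearMap.ker π := by
    refine (LinearMap.ker π).closed_of_finiteDimensional.mem_of_tendsto
      ((hasSum_nat_add_iff' K).2 hsum) (Filter.Eventually.of_forall fun A =>
        Submodule.sum_mem _ fun n _ => Submodule.smul_mem _ _ ?_)
    rw [LinearMap.mem_ker, hpow, pow_eq_zero_of_le (Nat.le_add_left K n) hS, LinearMap.zero_apply]
  rw [LinearMap.mem_ker, map_sub, sub_eq_zero] at hmem
  rw [hmem, map_sum, texp, LinearMap.sum_apply]
  refine Finset.sum_congr rfl fun n _ => ?_
  rw [map_smul, hpow]
  rfl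

variable {E : Type*} [NormedAddCommGroup E] [NormedSpace ℝ E] [FiniteDimensional ℝ E]
  {M : Type*} [TopologicalSpace M] [ChartedSpace E M] [IsManifold 𝓘(ℝ, E) ∞ M] [T2Space M]
  {N : ℕ} {F : WeightedSubRiem E M N}
  {V : Set.Icc 1 N → Type*} [∀ i, NormedAddCommGroup (V i)] [∀ i, NormedSpace ℝ (V i)]
  [∀ i, FiniteDimensional ℝ (V i)] (B : GradedBasis F V)

namespace GradedBasis

/-- An automorphism of `V` that maps `ker ♮_{y,t}` into `ker ♮_{y',t}` moves a defining map of the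
first kernel to a defining map of the second, since the kernels have the same dimension. -/
theorem comp_inverse_mem_kerGraph {f : (∀ i, V i) →L[ℝ] (Fin (Module.finrank ℝ E) → ℝ)} {y y' : M}
    {t : ℝ} (hf : (f, y, t) ∈ B.kerGraph) {Φ : (∀ i, V i) →L[ℝ] (∀ i, V i)} (hΦ : IsUnit Φ)
    (h : ∀ v, B.natAt y t v = 0 → B.natAt y' t (Φ v) = 0) :
    (f.comp (Ring.inverse Φ), y', t) ∈ B.kerGraph := by
  obtain ⟨ht, hk⟩ := hf
  dsimp only at ht hk
  have hinv : ∀ v, Φ (Ring.inverse Φ v) = v := DFunLike.congr_fun (Ring.mul_inverse_cancel _ hΦ)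
  have hinv' : ∀ v, Ring.inverse Φ (Φ v) = v := DFunLike.congr_fun (Ring.inverse_mul_cancel _ hΦ)
  have hfs : Function.Surjective f := by
    refine surjective_of_finrank_quotient_ker
      (f : (∀ i, V i) →ₗ[ℝ] (Fin (Module.finrank ℝ E) → ℝ)) ?_
    rw [hk]
    exact (kerGrass (W := TangentSpace 𝓘(ℝ, E) y) rfl (B.natAt y t) (B.natAt_surjective y ht)).2
  have hgs : Function.Surjective (f.comp (Ring.inverse Φ)) := fun c => by
    obtain ⟨v, rfl⟩ := hfs c
    exact ⟨Φ v, congrArg f (hinv' v)⟩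
  refine ⟨ht, Submodule.eq_of_le_of_finrank_eq (fun v hv => ?_) ?_⟩
  · have h1 : Ring.inverse Φ v ∈ LinearMap.ker (B.natAt y t) := hk ▸ hv
    have h2 := h _ h1
    rwa [hinv] at h2
  · have h1 := LinearMap.finrank_range_add_finrank_ker
      (f.comp (Ring.inverse Φ) : (∀ i, V i) →ₗ[ℝ] (Fin (Module.finrank ℝ E) → ℝ))
    have h2 := LinearMap.finrank_range_add_finrank_ker (B.natAt y' t)
    rw [LinearMap.range_eq_top.2 hgs, finrank_top, Module.finrank_fin_fun] at h1
    rw [LinearMap.range_eq_top.2 (B.natAt_surjective y' ht), finrank_top] at h2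
    change Module.finrank ℝ E + _ = _ at h2
    exact Nat.add_left_cancel (h1.trans h2.symm)

/-- For small `s ≥ 0` the adjoint action of `s • g` preserves the set of limit subspaces: it is the
limit of the maps by which the flow of `♮_t(g)` transports the kernels of `♮_{y,t}`. -/
theorem exists_forall_map_oscAd_smul {x : M} (g : F.Osc x) :
    ∃ ε > (0 : ℝ), ∀ s ∈ Set.Icc 0 ε, ∀ L ∈ B.limitSubspaces x, ∃ L' ∈ B.limitSubspaces x,
      L'.1 = L.1.map (WeightedSubRiem.oscAd (s • g)) := by
  obtain ⟨C, hC, hC0⟩ := B.exists_bracket_lift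
  obtain ⟨g, rfl⟩ := B.natZero_surjective x g
  let φ := extChartAt 𝓘(ℝ, E) x
  have hφx : φ.symm (φ x) = x := extChartAt_to_inv x
  obtain ⟨ε, hε, hflow⟩ := exists_kernel_flow (isOpen_extChartAt_target x) (B.contDiffOn_coordNat x)
    (C.contDiffOn_coordAd g x) (fun t z hz v => B.coordNat_bracket hC x t hz g v)
    (mem_extChartAt_target x) (fun z _ => B.coordNat_zero x z)
  refine ⟨ε, hε, fun s hs L hL => ?_⟩
  obtain ⟨ζ, Φ, hζ, hΦ, hζ0, hΦ0, hev⟩ := hflow s hs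
  set Φ₀ := Φ (0, φ x)
  have hunit : IsUnit Φ₀ := by
    rw [hΦ0]
    let _ := NormedAlgebra.restrictScalars ℚ ℝ ((∀ i, V i) →L[ℝ] (∀ i, V i))
    exact NormedSpace.isUnit_exp _
  -- at the limit the transport covers the adjoint action, as `C_{x,0}` covers the bracket
  have hAd : ∀ w, B.natZero x (Φ₀ w) =
      WeightedSubRiem.oscAd (s • B.natZero x g) (B.natZero x w) := fun w => by
    rw [hΦ0]
    refine map_exp_eq_texp (B.natZero x) _ _ (fun w => ?_)
      (neg_pow_eq_zero (WeightedSubRiem.ad_pow_eq_zero _)) w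
    change B.natZero x (s • -(C.coordAd g x (0, φ x) w)) = -⁅s • B.natZero x g, B.natZero x w⁆
    rw [C.coordAd_apply, map_smul, map_neg, smul_neg]
    dsimp only
    rw [hφx, hC0, smul_lie]
  have hbij := WeightedSubRiem.oscAd_bijective (s • B.natZero x g)
  let e := LinearEquiv.ofBijective _ hbij
  refine ⟨⟨L.1.map (WeightedSubRiem.oscAd (s • B.natZero x g)), ?_⟩, ?_, rfl⟩
  · exact (Submodule.Quotient.equiv L.1 (L.1.map (WeightedSubRiem.oscAd (s • B.natZero x g))) e
      rfl).finrank_eq.symm.trans L.2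
  obtain ⟨f₀, hf₀, hk, hcl⟩ := (B.mem_limitSubspaces_iff L).1 hL
  have hinv : ∀ v, Φ₀ (Ring.inverse Φ₀ v) = v :=
    DFunLike.congr_fun (Ring.mul_inverse_cancel _ hunit)
  have hinv' : ∀ v, Ring.inverse Φ₀ (Φ₀ v) = v :=
    DFunLike.congr_fun (Ring.inverse_mul_cancel _ hunit)
  refine (B.mem_limitSubspaces_iff _).2 ⟨f₀.comp (Ring.inverse Φ₀), fun c => ?_, ?_, ?_⟩
  · obtain ⟨v, rfl⟩ := hf₀ c
    exact ⟨Φ₀ v, congrArg f₀ (hinv' v)⟩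
  · ext w
    have h1 : w ∈ LinearMap.ker (f₀.comp (Ring.inverse Φ₀) :
        (∀ i, V i) →ₗ[ℝ] (Fin (Module.finrank ℝ E) → ℝ)) ↔
        B.natZero x (Ring.inverse Φ₀ w) ∈ L.1 := Submodule.ext_iff.1 hk (Ring.inverse Φ₀ w)
    rw [h1, Submodule.mem_comap, ← hinv w, hAd, hinv w]
    exact (Function.Injective.mem_set_image hbij.1).symm
  -- the transport of the triples `(f, y, t)` along the flow
  let j : ((∀ i, V i) →L[ℝ] (Fin (Module.finrank ℝ E) → ℝ)) × M × ℝ → ℝ × E :=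
    fun p => (p.2.2, φ p.2.1)
  have hj : ContinuousAt j (f₀, x, 0) :=
    continuous_snd.snd.continuousAt.prodMk
      ((continuousAt_extChartAt x).comp (f := fun p : ((∀ i, V i) →L[ℝ]
        (Fin (Module.finrank ℝ E) → ℝ)) × M × ℝ => p.2.1) (x := (f₀, x, 0))
        continuous_snd.fst.continuousAt)
  let Ξ : ((∀ i, V i) →L[ℝ] (Fin (Module.finrank ℝ E) → ℝ)) × M × ℝ →
      ((∀ i, V i) →L[ℝ] (Fin (Module.finrank ℝ E) → ℝ)) × M × ℝ :=
    fun p => (p.1.comp (Ring.inverse (Φ (j p))), φ.symm (ζ (j p)), p.2.2)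
  have hζj : Filter.Tendsto (fun p => ζ (j p)) (𝓝 (f₀, x, 0)) (𝓝 (φ x)) := by
    have := hζ.tendsto.comp hj.tendsto
    rwa [hζ0] at this
  have hΦj : Filter.Tendsto (fun p => Φ (j p)) (𝓝 (f₀, x, 0)) (𝓝 Φ₀) := hΦ.tendsto.comp hj.tendsto
  have hΞ : Filter.Tendsto Ξ (𝓝 (f₀, x, 0)) (𝓝 (f₀.comp (Ring.inverse Φ₀), x, 0)) := by
    refine Filter.Tendsto.prodMk_nhds ?_ (Filter.Tendsto.prodMk_nhds ?_
      continuous_snd.snd.continuousAt)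
    · have h1 : Filter.Tendsto (fun p => Ring.inverse (Φ (j p))) (𝓝 (f₀, x, (0 : ℝ)))
          (𝓝 (Ring.inverse Φ₀)) := by
        obtain ⟨u, hu⟩ := hunit
        have h2 := NormedRing.inverse_continuousAt u
        rw [hu] at h2
        exact h2.tendsto.comp hΦj
      have hfst : Filter.Tendsto (fun p : ((∀ i, V i) →L[ℝ]
          (Fin (Module.finrank ℝ E) → ℝ)) × M × ℝ => p.1) (𝓝 (f₀, x, 0)) (𝓝 f₀) :=
        continuous_fst.continuousAt
      exact (isBoundedBilinearMap_comp.continuous.tendsto (f₀, Ring.inverse Φ₀)).comp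
        (hfst.prodMk_nhds h1)
    · have h1 := (continuousAt_extChartAt_symm (I := 𝓘(ℝ, E)) x).tendsto.comp hζj
      rwa [extChartAt_to_inv] at h1
  refine mem_closure_iff_frequently.2 (hΞ.frequently ?_)
  have hsrc : ∀ᶠ p : ((∀ i, V i) →L[ℝ] (Fin (Module.finrank ℝ E) → ℝ)) × M × ℝ in
      𝓝 (f₀, x, (0 : ℝ)), p.2.1 ∈ φ.source :=
    continuous_snd.fst.continuousAt.eventually (extChartAt_source_mem_nhds x)
  have hu : ∀ᶠ p in 𝓝 (f₀, x, (0 : ℝ)), IsUnit (Φ (j p)) :=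
    hΦj.eventually (Units.isOpen.mem_nhds hunit)
  refine ((mem_closure_iff_frequently.1 hcl).and_eventually
    (hsrc.and (hu.and (hj.eventually hev)))).mono ?_
  rintro ⟨f, y, t⟩ ⟨hf, hy, hunit', hζt, hker⟩
  refine B.comp_inverse_mem_kerGraph hf hunit' fun v hv => ?_
  rw [← coordNat_apply_eq_zero_iff B hζt]
  refine hker v ?_
  have h1 : φ.symm (φ y) = y := φ.left_inv hy
  refine (coordNat_apply_eq_zero_iff B (φ.map_source hy) v).2 ?_
  rw [h1]
  exact hv

/-- The adjoint action of every `g` preserves the set of limit subspaces: it is a power of the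
adjoint action of a small multiple of `g`. -/
theorem exists_mem_limitSubspaces_eq_map_oscAd {x : M} (g : F.Osc x) {L : F.GrassAt x}
    (hL : L ∈ B.limitSubspaces x) :
    ∃ L' ∈ B.limitSubspaces x, L'.1 = L.1.map (WeightedSubRiem.oscAd g) := by
  obtain ⟨ε, hε, h⟩ := B.exists_forall_map_oscAd_smul g
  obtain ⟨m, hm⟩ := exists_nat_one_div_lt hε
  set s : ℝ := 1 / ((m : ℝ) + 1) with hs
  have hs0 : 0 < s := by positivity
  have hg : g = ((m + 1 : ℕ) : ℝ) • s • g := by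
    rw [smul_smul, hs, Nat.cast_add_one, mul_one_div_cancel (by positivity), one_smul]
  rw [hg, WeightedSubRiem.oscAd_natCast_smul]
  generalize m + 1 = k
  induction k with
  | zero => exact ⟨L, hL, by rw [pow_zero, Module.End.one_eq_id, Submodule.map_id]⟩
  | succ k ih =>
    obtain ⟨L₁, hL₁, h₁⟩ := ih
    obtain ⟨L₂, hL₂, h₂⟩ := h s ⟨hs0.le, hm.le⟩ L₁ hL₁
    exact ⟨L₂, hL₂, by rw [h₂, h₁, ← Submodule.map_comp, pow_succ', Module.End.mul_eq_comp]⟩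

/-- The limit subspaces are subalgebras and subgroups, and conjugation permutes them; for a graded
basis whose pieces carry norms. -/
theorem limitSubspaces_properties (x : M) :
    (∀ L ∈ B.limitSubspaces x,
      (∃ K : LieSubalgebra ℝ (F.Osc x), K.toSubmodule = L.1) ∧
        WeightedSubRiem.IsOscSubgroup (L.1 : Set (F.Osc x))) ∧
    ∀ g : F.Osc x, ∀ L ∈ B.limitSubspaces x, ∃ L' ∈ B.limitSubspaces x,
      (L'.1 : Set (F.Osc x)) =
        (fun v => WeightedSubRiem.oscConj g v) '' (L.1 : Set (F.Osc x)) := by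
  refine ⟨fun L hL => ?_, fun g L hL => ?_⟩
  · let K : LieSubalgebra ℝ (F.Osc x) :=
      { L.1 with lie_mem' := fun hu hv => B.lie_mem_of_mem_limitSubspaces hL hu hv }
    exact ⟨⟨K, rfl⟩, L.1.zero_mem, fun u hu v hv => bchMul_mem K N hu hv,
      fun u hu => L.1.neg_mem hu⟩
  · obtain ⟨L', hL', h⟩ := B.exists_mem_limitSubspaces_eq_map_oscAd g hL
    refine ⟨L', hL', ?_⟩
    rw [h, Submodule.map_coe]
    exact Set.image_congr fun v _ => (WeightedSubRiem.oscConj_eq_oscAd g v).symm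

end GradedBasis

end Conjugation

end SubRiem

end

theorem mainTheorem2 {E : Type*} [NormedAddCommGroup E] [NormedSpace ℝ E] [FiniteDimensional ℝ E]
    {M : Type*} [TopologicalSpace M] [ChartedSpace E M] [IsManifold 𝓘(ℝ, E) ∞ M]
    [T2Space M] [SecondCountableTopology M]
    {N : ℕ} (F : SubRiem.WeightedSubRiem E M N)
    {V : Set.Icc 1 N → Type*} [∀ i, AddCommGroup (V i)] [∀ i, Module ℝ (V i)]
    [∀ i, FiniteDimensional ℝ (V i)] (B : SubRiem.GradedBasis F V) (x : M) :
    (∀ L ∈ B.limitSubspaces x,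
      (∃ K : LieSubalgebra ℝ (F.Osc x), K.toSubmodule = L.1) ∧
        SubRiem.WeightedSubRiem.IsOscSubgroup (L.1 : Set (F.Osc x))) ∧
    ∀ g : F.Osc x, ∀ L ∈ B.limitSubspaces x, ∃ L' ∈ B.limitSubspaces x,
      (L'.1 : Set (F.Osc x)) =
        (fun v => SubRiem.WeightedSubRiem.oscConj g v) '' (L.1 : Set (F.Osc x)) := by
  -- the topology of the Grassmannian does not refer to norms, so any norms of the `V i` will do
  let e : ∀ i, V i ≃ₗ[ℝ] (Fin (Module.finrank ℝ (V i)) → ℝ) := fun i =>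
    (Module.finBasis ℝ (V i)).equivFun
  let _ : ∀ i, NormedAddCommGroup (V i) := fun i =>
    NormedAddCommGroup.induced (V i) _ (e i) (e i).injective
  let _ : ∀ i, NormedSpace ℝ (V i) := fun i => NormedSpace.induced ℝ (V i) _ (e i)
  exact B.limitSubspaces_properties x
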